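/- **Theorem (Completeness of declarative subsorting for LF with refinements).** *Syntax* (up to $\alpha$-equivalence; $c$, $a$, $s$ range over term, type and sort constants): atomic terms $R ::= c \mid x \mid R\,N$; normal terms $N ::= R \mid \lambda x.N$; atomic types $P ::= a \mid P\,N$; types $A ::= P \mid \Pi x{:}A_1.A_2$; kinds $K ::= \mathsf{type} \mid \Pi x{:}A.K$; atomic sorts $Q ::= s \mid Q\,N$; sorts $S,T ::= Q \mid \Pi x{::}S_1{\sqsubset}A_1.S_2 \mid \top \mid S_1\wedge S_2$; classes $L ::= \mathsf{sort} \mid \Pi x{::}S{\sqsubset}A.L \mid \top \mid L_1\wedge L_2$. A signature $\Sigma$ is a list of declarations $a{:}K$, $c{:}A$, $s\sqsubset a::L$, $s_1\le s_2$, $c::S$; a context $\Gamma$ is a list of declarations $x{::}S{\sqsubset}A$, and $\Gamma^*$ denotes the LF context obtained by replacing each of them by $x{:}A$. Simple types are $\alpha ::= a \mid \alpha_1\to\alpha_2$; a type $A$ erases to the simple type $A^-$ by $(a\,N_1\cdots N_n)^-=a$, $(\Pi x{:}A.B)^-=A^-\to B^-$. The $\eta$-expansion is $\eta_a(R)=R$,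 $\eta_{\alpha\to\beta}(R)=\lambda x.\,\eta_\beta(R\,(\eta_\alpha(x)))$, and $\eta_A=\eta_{A^-}$. *Hereditary substitution* $[N_0/x_0]_{\alpha_0}$ is the partial function that is compositional on all syntactic categories except at atomic terms $R$ with head $x_0$. For these there is an auxiliary partial function with values (normal term, simple type): $x_0\mapsto(N_0,\alpha_0)$, and if $R_1\mapsto(\lambda x.N_1,\alpha_2\to\alpha_1)$, $[N_0/x_0]_{\alpha_0}N_2=N_2'$ and $[N_2'/x]_{\alpha_2}N_1=N_1'$, then $R_1\,N_2\mapsto(N_1',\alpha_1)$; and $[N_0/x_0]_{\alpha_0}R=R'$ if $R\mapsto(R',a)$ with $R'$ atomic. We write $[N/x]_A$ for $[N/x]_{A^-}$. *Sorting.* Atomic subsorting $Q_1\le Q_2$ is the reflexive-transitive closure of $s_1\,N_1\cdots N_n\le s_2\,N_1\cdots N_n$ for $s_1\le s_2\in\Sigma$. Synthesis: $\Gamma\vdash c\Rightarrow S$ if $c::S\in\Sigma$; $\Gamma\vdash x\Rightarrow S$ if $x{::}S{\sqsubset}A\in\Gamma$; $\Gamma\vdash R\,N\Rightarrow [N/x]_A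 T$ if $\Gamma\vdash R\Rightarrow\Pi x{::}S{\sqsubset}A.T$, $\Gamma\vdash N\Leftarrow S$ and the substitution is defined; $\Gamma\vdash R\Rightarrow S_i$ if $\Gamma\vdash R\Rightarrow S_1\wedge S_2$. Checking: $\Gamma\vdash R\Leftarrow Q$ if $\Gamma\vdash R\Rightarrow Q'$ and $Q'\le Q$; $\Gamma\vdash\lambda x.N\Leftarrow\Pi x{::}S{\sqsubset}A.T$ if $\Gamma,x{::}S{\sqsubset}A\vdash N\Leftarrow T$; $\Gamma\vdash N\Leftarrow\top$ always; $\Gamma\vdash N\Leftarrow S_1\wedge S_2$ if $\Gamma\vdash N\Leftarrow S_1$ and $\Gamma\vdash N\Leftarrow S_2$. *Refinement.* $\Gamma\vdash s\sqsubset a\Rightarrow L$ if $s\sqsubset a::L\in\Sigma$; $\Gamma\vdash Q\,N\sqsubset P\,N\Rightarrow[N/x]_A L$ if $\Gamma\vdash Q\sqsubset P\Rightarrow\Pi x{::}S{\sqsubset}A.L$, $\Gamma\vdash N\Leftarrow S$ and the substitution is defined; $\Gamma\vdash Q\sqsubset P\Rightarrow L_i$ if $\Gamma\vdash Q\sqsubset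 P\Rightarrow L_1\wedge L_2$. Then $\Gamma\vdash Q\sqsubset P$ if $\Gamma\vdash Q\sqsubset P\Rightarrow\mathsf{sort}$; $\Gamma\vdash\Pi x{::}S{\sqsubset}A.S'\sqsubset\Pi x{:}A.A'$ if $\Gamma\vdash S\sqsubset A$ and $\Gamma,x{::}S{\sqsubset}A\vdash S'\sqsubset A'$; $\Gamma\vdash\top\sqsubset A$ always; $\Gamma\vdash S_1\wedge S_2\sqsubset A$ if $\Gamma\vdash S_1\sqsubset A$ and $\Gamma\vdash S_2\sqsubset A$. Refinement $L\sqsubset K$ of kinds by classes is defined in the same way from $\mathsf{sort}\sqsubset\mathsf{type}$. $\Sigma$ is well formed if each of its declarations is well formed over the preceding ones: $a{:}K$ with $K$ a kind and $c{:}A$ with $A$ a type of canonical LF; $s\sqsubset a::L$ with $a{:}K$ declared and $L\sqsubset K$; $c::S$ with $c{:}A$ declared and $S\sqsubset A$; $s_1\le s_2$ with $s_1\sqsubset a::L$ and $s_2\sqsubset a::L$ declared for the same $a$ and $L$; and each constant has at most one declaration of each of the first four forms. $\Gamma$ is well formed if for each of its declarations $x{::}S{\sqsubset}A$, over the preceding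 part $\Gamma_0$, $A$ is a type of canonical LF in $\Gamma_0^*$ and $\Gamma_0\vdash S\sqsubset A$. *Declarative subsorting* $\Gamma\vdash S\le T\sqsubset A$, between sorts $S,T$ that refine the same type $A$ in $\Gamma$ (for every judgment in a derivation, both sorts are required to refine the indicated type in the indicated context; the indices $\Gamma$, $A$ are usually omitted), is generated by atomic subsorting $Q_1\le Q_2$ and the rules: $S\le S$; from $S_1\le S_2$ and $S_2\le S_3$ infer $S_1\le S_3$; from $\Gamma\vdash S_2\le S_1\sqsubset A$ and $\Gamma,x{::}S_2{\sqsubset}A\vdash T_1\le T_2\sqsubset A'$ infer $\Gamma\vdash\Pi x{::}S_1{\sqsubset}A.T_1\le\Pi x{::}S_2{\sqsubset}A.T_2\sqsubset\Pi x{:}A.A'$; $S\le\top$; from $T\le S_1$ and $T\le S_2$ infer $T\le S_1\wedge S_2$; from $S_i\le T$ infer $S_1\wedge S_2\le T$ ($i=1,2$); $\top\le\Pi x{::}S{\sqsubset}A.\top$; $(\Pi x{::}S{\sqsubset}A.T_1)\wedge(\Pi x{::}S{\sqsubset}A.T_2)\le\Pi x{::}S{\sqsubset}A.(T_1\wedge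 T_2)$. *Claim.* Let $\Sigma$ be a well-formed signature, $\Gamma$ a well-formed context, $A$ a well-formed type of canonical LF in $\Gamma^*$, and $S,T$ sorts with $\Gamma\vdash S\sqsubset A$ and $\Gamma\vdash T\sqsubset A$. If $$\Gamma,\,x{::}S{\sqsubset}A\;\vdash\;\eta_A(x)\Leftarrow T,$$ then $\Gamma\vdash S\le T\sqsubset A$ is derivable; in particular $S\le T$ is derivable with the declarative subsorting rules. -/

import Mathlib

/-!
LF with refinements (LFR), canonical-forms presentation.

Bound and context variables are de Bruijn indices, so that α-equivalent objects are equal.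
A context is a list whose head is the most recent declaration.  A signature is likewise a list
whose head is the most recent declaration.  Term constants `c`, type constants `a` and sort
constants `s` are three separate families of names, each indexed by natural numbers.
-/

namespace LFR

/-! ### Grammar -/

mutual
/-- Atomic terms `R ::= c | x | R N`. -/
inductive Atom : Type
  | const (c : ℕ) : Atom
  | var (i : ℕ) : Atom
  | app (R : Atom) (N : Norm) : Atom
/-- Normal terms `N ::= R | λx. N`. -/
inductive Norm : Type
  | atom (R : Atom) : Norm
  | lam (N : Norm) : Norm
end

/-- Atomic type families `P ::= a | P N`. -/
inductive AtomTy : Type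
  | const (a : ℕ) : AtomTy
  | app (P : AtomTy) (N : Norm) : AtomTy

/-- Normal type families `A ::= P | Πx:A₁. A₂`. -/
inductive Ty : Type
  | atom (P : AtomTy) : Ty
  | pi (A₁ A₂ : Ty) : Ty

/-- Kinds `K ::= type | Πx:A. K`. -/
inductive Knd : Type
  | type : Knd
  | pi (A : Ty) (K : Knd) : Knd

/-- Atomic sort families `Q ::= s | Q N`. -/
inductive AtomSrt : Type
  | const (s : ℕ) : AtomSrt
  | app (Q : AtomSrt) (N : Norm) : AtomSrt

/-- Normal sort families `S ::= Q | Πx::S₁⊏A₁. S₂ | ⊤ | S₁ ∧ S₂`. -/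
inductive Srt : Type
  | atom (Q : AtomSrt) : Srt
  | pi (S₁ : Srt) (A₁ : Ty) (S₂ : Srt) : Srt
  | top : Srt
  | inter (S₁ S₂ : Srt) : Srt

/-- Classes `L ::= sort | Πx::S⊏A. L | ⊤ | L₁ ∧ L₂`. -/
inductive Cls : Type
  | sort : Cls
  | pi (S : Srt) (A : Ty) (L : Cls) : Cls
  | top : Cls
  | inter (L₁ L₂ : Cls) : Cls

/-- Signature declarations `a : K`, `c : A`, `s ⊏ a :: L`, `s₁ ≤ s₂`, `c :: S`. -/
inductive Decl : Type
  | tyConst (a : ℕ) (K : Knd) : Decl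
  | tmConst (c : ℕ) (A : Ty) : Decl
  | srtConst (s a : ℕ) (L : Cls) : Decl
  | subsort (s₁ s₂ : ℕ) : Decl
  | tmSrt (c : ℕ) (S : Srt) : Decl

abbrev Sig : Type := List Decl

/-- LFR contexts: a list of declarations `x :: S ⊏ A`. -/
abbrev Ctx : Type := List (Srt × Ty)

/-- The LF context underlying an LFR context: each `x :: S ⊏ A` becomes `x : A`. -/
def Ctx.erase (Γ : Ctx) : List Ty := Γ.map Prod.snd

/-! ### Renaming of variables -/

/-- Extension of a renaming under one binder. -/
def upRen (ξ : ℕ → ℕ) : ℕ → ℕ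
  | 0 => 0
  | i + 1 => ξ i + 1

mutual
def Atom.ren (ξ : ℕ → ℕ) : Atom → Atom
  | .const c => .const c
  | .var i => .var (ξ i)
  | .app R N => .app (R.ren ξ) (N.ren ξ)
def Norm.ren (ξ : ℕ → ℕ) : Norm → Norm
  | .atom R => .atom (R.ren ξ)
  | .lam N => .lam (N.ren (upRen ξ))
end

def AtomTy.ren (ξ : ℕ → ℕ) : AtomTy → AtomTy
  | .const a => .const a
  | .app P N => .app (P.ren ξ) (N.ren ξ)

def Ty.ren (ξ : ℕ → ℕ) : Ty → Ty
  | .atom P => .atom (P.ren ξ)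
  | .pi A₁ A₂ => .pi (A₁.ren ξ) (A₂.ren (upRen ξ))

def AtomSrt.ren (ξ : ℕ → ℕ) : AtomSrt → AtomSrt
  | .const s => .const s
  | .app Q N => .app (Q.ren ξ) (N.ren ξ)

def Srt.ren (ξ : ℕ → ℕ) : Srt → Srt
  | .atom Q => .atom (Q.ren ξ)
  | .pi S₁ A₁ S₂ => .pi (S₁.ren ξ) (A₁.ren ξ) (S₂.ren (upRen ξ))
  | .top => .top
  | .inter S₁ S₂ => .inter (S₁.ren ξ) (S₂.ren ξ)

/-- Weakening by one new most recent variable. -/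
def Atom.shift (R : Atom) : Atom := R.ren Nat.succ
def Norm.shift (N : Norm) : Norm := N.ren Nat.succ
def Ty.shift (A : Ty) : Ty := A.ren Nat.succ
def Srt.shift (S : Srt) : Srt := S.ren Nat.succ

/-- `Lookup Γ i S`: variable `i` is declared with sort `S` in `Γ`. -/
inductive Lookup : Ctx → ℕ → Srt → Prop
  | zero (Γ : Ctx) (S : Srt) (A : Ty) : Lookup ((S, A) :: Γ) 0 S.shift
  | succ {Γ : Ctx} {i : ℕ} {S : Srt} (d : Srt × Ty) :
      Lookup Γ i S → Lookup (d :: Γ) (i + 1) S.shift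

/-- `LookupTy Γ i A`: variable `i` is declared with type `A` in the LF context `Γ`. -/
inductive LookupTy : List Ty → ℕ → Ty → Prop
  | zero (Γ : List Ty) (A : Ty) : LookupTy (A :: Γ) 0 A.shift
  | succ {Γ : List Ty} {i : ℕ} {A : Ty} (B : Ty) :
      LookupTy Γ i A → LookupTy (B :: Γ) (i + 1) A.shift

/-! ### Simple types and η-expansion -/

/-- Simple types `α ::= a | α₁ → α₂`. -/
inductive STy : Type
  | base (a : ℕ) : STy
  | arr (α₁ α₂ : STy) : STy

def AtomTy.erase : AtomTy → STy
  | .const a => .base a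
  | .app P _ => P.erase

/-- Erasure of a dependent type to a simple type. -/
def Ty.erase : Ty → STy
  | .atom P => P.erase
  | .pi A₁ A₂ => .arr A₁.erase A₂.erase

/-- η-expansion: `η_a(R) = R` and `η_{α→β}(R) = λx. η_β(R (η_α(x)))`. -/
def eta : STy → Atom → Norm
  | .base _, R => .atom R
  | .arr α β, R => .lam (eta β (.app R.shift (eta α (.var 0))))

/-! ### Hereditary substitution

`HSubN k N₀ α₀ N N'` is `[N₀/x]_{α₀} N = N'` where `x` is the variable with index `k` in `N`.
The index `k` is removed: larger indices drop by one.  The term `N₀` and the result live in the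
context without `x`. -/

mutual
/-- Substitution into normal terms. -/
inductive HSubN : ℕ → Norm → STy → Norm → Norm → Prop
  | atomNorm {k : ℕ} {N₀ : Norm} {α₀ : STy} {R R' : Atom} {a : ℕ} :
      HSubRN k N₀ α₀ R (.atom R') (.base a) → HSubN k N₀ α₀ (.atom R) (.atom R')
  | atom {k : ℕ} {N₀ : Norm} {α₀ : STy} {R R' : Atom} :
      HSubRR k N₀ α₀ R R' → HSubN k N₀ α₀ (.atom R) (.atom R')
  | lam {k : ℕ} {N₀ : Norm} {α₀ : STy} {N M : Norm} :
      HSubN (k + 1) N₀.shift α₀ N M → HSubN k N₀ α₀ (.lam N) (.lam M)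
/-- Substitution into atomic terms whose head is not the substituted variable. -/
inductive HSubRR : ℕ → Norm → STy → Atom → Atom → Prop
  | varLt {k : ℕ} {N₀ : Norm} {α₀ : STy} {i : ℕ} :
      i < k → HSubRR k N₀ α₀ (.var i) (.var i)
  | varGt {k : ℕ} {N₀ : Norm} {α₀ : STy} {i : ℕ} :
      k ≤ i → HSubRR k N₀ α₀ (.var (i + 1)) (.var i)
  | const {k : ℕ} {N₀ : Norm} {α₀ : STy} {c : ℕ} :
      HSubRR k N₀ α₀ (.const c) (.const c)
  | app {k : ℕ} {N₀ : Norm} {α₀ : STy} {R R' : Atom} {N M : Norm} :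
      HSubRR k N₀ α₀ R R' → HSubN k N₀ α₀ N M →
      HSubRR k N₀ α₀ (.app R N) (.app R' M)
/-- Substitution into atomic terms whose head is the substituted variable. -/
inductive HSubRN : ℕ → Norm → STy → Atom → Norm → STy → Prop
  | var {k : ℕ} {N₀ : Norm} {α₀ : STy} :
      HSubRN k N₀ α₀ (.var k) N₀ α₀
  | beta {k : ℕ} {N₀ : Norm} {α₀ : STy} {R₁ : Atom} {N₁ N₁' N₂ N₂' : Norm} {α₁ α₂ : STy} :
      HSubRN k N₀ α₀ R₁ (.lam N₁) (.arr α₂ α₁) → HSubN k N₀ α₀ N₂ N₂' →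
      HSubN 0 N₂' α₂ N₁ N₁' → HSubRN k N₀ α₀ (.app R₁ N₂) N₁' α₁
end

inductive HSubP (k : ℕ) (N₀ : Norm) (α₀ : STy) : AtomTy → AtomTy → Prop
  | const {a : ℕ} : HSubP k N₀ α₀ (.const a) (.const a)
  | app {P P' : AtomTy} {N N' : Norm} :
      HSubP k N₀ α₀ P P' → HSubN k N₀ α₀ N N' → HSubP k N₀ α₀ (.app P N) (.app P' N')

inductive HSubA : ℕ → Norm → STy → Ty → Ty → Prop
  | atom {k : ℕ} {N₀ : Norm} {α₀ : STy} {P P' : AtomTy} :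
      HSubP k N₀ α₀ P P' → HSubA k N₀ α₀ (.atom P) (.atom P')
  | pi {k : ℕ} {N₀ : Norm} {α₀ : STy} {A A' B B' : Ty} :
      HSubA k N₀ α₀ A A' → HSubA (k + 1) N₀.shift α₀ B B' →
      HSubA k N₀ α₀ (.pi A B) (.pi A' B')

inductive HSubK : ℕ → Norm → STy → Knd → Knd → Prop
  | type {k : ℕ} {N₀ : Norm} {α₀ : STy} : HSubK k N₀ α₀ .type .type
  | pi {k : ℕ} {N₀ : Norm} {α₀ : STy} {A A' : Ty} {K K' : Knd} :
      HSubA k N₀ α₀ A A' → HSubK (k + 1) N₀.shift α₀ K K' →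
      HSubK k N₀ α₀ (.pi A K) (.pi A' K')

inductive HSubQ (k : ℕ) (N₀ : Norm) (α₀ : STy) : AtomSrt → AtomSrt → Prop
  | const {s : ℕ} : HSubQ k N₀ α₀ (.const s) (.const s)
  | app {Q Q' : AtomSrt} {N N' : Norm} :
      HSubQ k N₀ α₀ Q Q' → HSubN k N₀ α₀ N N' → HSubQ k N₀ α₀ (.app Q N) (.app Q' N')

inductive HSubS : ℕ → Norm → STy → Srt → Srt → Prop
  | atom {k : ℕ} {N₀ : Norm} {α₀ : STy} {Q Q' : AtomSrt} :
      HSubQ k N₀ α₀ Q Q' → HSubS k N₀ α₀ (.atom Q) (.atom Q')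
  | pi {k : ℕ} {N₀ : Norm} {α₀ : STy} {S S' T T' : Srt} {A A' : Ty} :
      HSubS k N₀ α₀ S S' → HSubA k N₀ α₀ A A' → HSubS (k + 1) N₀.shift α₀ T T' →
      HSubS k N₀ α₀ (.pi S A T) (.pi S' A' T')
  | top {k : ℕ} {N₀ : Norm} {α₀ : STy} : HSubS k N₀ α₀ .top .top
  | inter {k : ℕ} {N₀ : Norm} {α₀ : STy} {S₁ S₁' S₂ S₂' : Srt} :
      HSubS k N₀ α₀ S₁ S₁' → HSubS k N₀ α₀ S₂ S₂' →
      HSubS k N₀ α₀ (.inter S₁ S₂) (.inter S₁' S₂')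

inductive HSubL : ℕ → Norm → STy → Cls → Cls → Prop
  | sort {k : ℕ} {N₀ : Norm} {α₀ : STy} : HSubL k N₀ α₀ .sort .sort
  | pi {k : ℕ} {N₀ : Norm} {α₀ : STy} {S S' : Srt} {A A' : Ty} {L L' : Cls} :
      HSubS k N₀ α₀ S S' → HSubA k N₀ α₀ A A' → HSubL (k + 1) N₀.shift α₀ L L' →
      HSubL k N₀ α₀ (.pi S A L) (.pi S' A' L')
  | top {k : ℕ} {N₀ : Norm} {α₀ : STy} : HSubL k N₀ α₀ .top .top
  | inter {k : ℕ} {N₀ : Norm} {α₀ : STy} {L₁ L₂ M₁ M₂ : Cls} :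
      HSubL k N₀ α₀ L₁ M₁ → HSubL k N₀ α₀ L₂ M₂ →
      HSubL k N₀ α₀ (.inter L₁ L₂) (.inter M₁ M₂)

/-! ### Canonical LF

These judgments consult only the declarations `a : K` and `c : A` of the signature, so they are
the judgments over the LF part of the signature. -/

mutual
/-- `Γ ⊢ R ⇒ A`. -/
inductive TmSynth (Sg : Sig) : List Ty → Atom → Ty → Prop
  | var {Γ : List Ty} {i : ℕ} {A : Ty} : LookupTy Γ i A → TmSynth Sg Γ (.var i) A
  | const {Γ : List Ty} {c : ℕ} {A : Ty} : Decl.tmConst c A ∈ Sg → TmSynth Sg Γ (.const c) A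
  | app {Γ : List Ty} {R : Atom} {N : Norm} {A B C : Ty} :
      TmSynth Sg Γ R (.pi A B) → TmCheck Sg Γ N A → HSubA 0 N A.erase B C →
      TmSynth Sg Γ (.app R N) C
/-- `Γ ⊢ N ⇐ A`. -/
inductive TmCheck (Sg : Sig) : List Ty → Norm → Ty → Prop
  | switch {Γ : List Ty} {R : Atom} {P : AtomTy} :
      TmSynth Sg Γ R (.atom P) → TmCheck Sg Γ (.atom R) (.atom P)
  | lam {Γ : List Ty} {N : Norm} {A B : Ty} :
      TmCheck Sg (A :: Γ) N B → TmCheck Sg Γ (.lam N) (.pi A B)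
end

/-- `Γ ⊢ P ⇒ K`. -/
inductive TySynth (Sg : Sig) (Γ : List Ty) : AtomTy → Knd → Prop
  | const {a : ℕ} {K : Knd} : Decl.tyConst a K ∈ Sg → TySynth Sg Γ (.const a) K
  | app {P : AtomTy} {N : Norm} {A : Ty} {K K₁ : Knd} :
      TySynth Sg Γ P (.pi A K) → TmCheck Sg Γ N A → HSubK 0 N A.erase K K₁ →
      TySynth Sg Γ (.app P N) K₁

/-- `Γ ⊢ A ⇐ type`. -/
inductive TyOK (Sg : Sig) : List Ty → Ty → Prop
  | atom {Γ : List Ty} {P : AtomTy} : TySynth Sg Γ P .type → TyOK Sg Γ (.atom P)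
  | pi {Γ : List Ty} {A B : Ty} : TyOK Sg Γ A → TyOK Sg (A :: Γ) B → TyOK Sg Γ (.pi A B)

/-- `Γ ⊢ K kind`. -/
inductive KndOK (Sg : Sig) : List Ty → Knd → Prop
  | type {Γ : List Ty} : KndOK Sg Γ .type
  | pi {Γ : List Ty} {A : Ty} {K : Knd} :
      TyOK Sg Γ A → KndOK Sg (A :: Γ) K → KndOK Sg Γ (.pi A K)

/-! ### Sort checking -/

/-- One step `Q₁ ≤ Q₂` of declared subsorting, closed under application to equal arguments. -/
inductive AtomSubStep (Sg : Sig) : AtomSrt → AtomSrt → Prop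
  | decl {s₁ s₂ : ℕ} : Decl.subsort s₁ s₂ ∈ Sg → AtomSubStep Sg (.const s₁) (.const s₂)
  | app {Q₁ Q₂ : AtomSrt} {N : Norm} :
      AtomSubStep Sg Q₁ Q₂ → AtomSubStep Sg (.app Q₁ N) (.app Q₂ N)

/-- Subsorting `Q₁ ≤ Q₂` of atomic sorts: reflexive-transitive closure of the above. -/
inductive AtomSub (Sg : Sig) : AtomSrt → AtomSrt → Prop
  | refl {Q : AtomSrt} : AtomSub Sg Q Q
  | step {Q₁ Q' Q₂ : AtomSrt} :
      AtomSubStep Sg Q₁ Q' → AtomSub Sg Q' Q₂ → AtomSub Sg Q₁ Q₂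

mutual
/-- `Γ ⊢ R ⇒ S`. -/
inductive SortSynth (Sg : Sig) : Ctx → Atom → Srt → Prop
  | const {Γ : Ctx} {c : ℕ} {S : Srt} : Decl.tmSrt c S ∈ Sg → SortSynth Sg Γ (.const c) S
  | var {Γ : Ctx} {i : ℕ} {S : Srt} : Lookup Γ i S → SortSynth Sg Γ (.var i) S
  | app {Γ : Ctx} {R : Atom} {N : Norm} {S T T' : Srt} {A : Ty} :
      SortSynth Sg Γ R (.pi S A T) → SortCheck Sg Γ N S → HSubS 0 N A.erase T T' →
      SortSynth Sg Γ (.app R N) T'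
  | interE₁ {Γ : Ctx} {R : Atom} {S₁ S₂ : Srt} :
      SortSynth Sg Γ R (.inter S₁ S₂) → SortSynth Sg Γ R S₁
  | interE₂ {Γ : Ctx} {R : Atom} {S₁ S₂ : Srt} :
      SortSynth Sg Γ R (.inter S₁ S₂) → SortSynth Sg Γ R S₂
/-- `Γ ⊢ N ⇐ S`. -/
inductive SortCheck (Sg : Sig) : Ctx → Norm → Srt → Prop
  | switch {Γ : Ctx} {R : Atom} {Q Q' : AtomSrt} :
      SortSynth Sg Γ R (.atom Q') → AtomSub Sg Q' Q → SortCheck Sg Γ (.atom R) (.atom Q)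
  | lam {Γ : Ctx} {N : Norm} {S T : Srt} {A : Ty} :
      SortCheck Sg ((S, A) :: Γ) N T → SortCheck Sg Γ (.lam N) (.pi S A T)
  | top {Γ : Ctx} {N : Norm} : SortCheck Sg Γ N .top
  | inter {Γ : Ctx} {N : Norm} {S₁ S₂ : Srt} :
      SortCheck Sg Γ N S₁ → SortCheck Sg Γ N S₂ → SortCheck Sg Γ N (.inter S₁ S₂)
end

/-! ### Refinement -/

/-- `Γ ⊢ Q ⊏ P ⇒ L`: the atomic sort `Q` refines the atomic type `P` and has class `L`. -/
inductive ClsSynth (Sg : Sig) (Γ : Ctx) : AtomSrt → AtomTy → Cls → Prop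
  | const {s a : ℕ} {L : Cls} :
      Decl.srtConst s a L ∈ Sg → ClsSynth Sg Γ (.const s) (.const a) L
  | app {Q : AtomSrt} {P : AtomTy} {N : Norm} {S : Srt} {A : Ty} {L L' : Cls} :
      ClsSynth Sg Γ Q P (.pi S A L) → SortCheck Sg Γ N S → HSubL 0 N A.erase L L' →
      ClsSynth Sg Γ (.app Q N) (.app P N) L'
  | interE₁ {Q : AtomSrt} {P : AtomTy} {L₁ L₂ : Cls} :
      ClsSynth Sg Γ Q P (.inter L₁ L₂) → ClsSynth Sg Γ Q P L₁
  | interE₂ {Q : AtomSrt} {P : AtomTy} {L₁ L₂ : Cls} :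
      ClsSynth Sg Γ Q P (.inter L₁ L₂) → ClsSynth Sg Γ Q P L₂

/-- `Γ ⊢ S ⊏ A`: the sort `S` is well formed and refines the type `A`. -/
inductive Refines (Sg : Sig) : Ctx → Srt → Ty → Prop
  | atom {Γ : Ctx} {Q : AtomSrt} {P : AtomTy} :
      ClsSynth Sg Γ Q P .sort → Refines Sg Γ (.atom Q) (.atom P)
  | pi {Γ : Ctx} {S S' : Srt} {A A' : Ty} :
      Refines Sg Γ S A → Refines Sg ((S, A) :: Γ) S' A' →
      Refines Sg Γ (.pi S A S') (.pi A A')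
  | top {Γ : Ctx} {A : Ty} : Refines Sg Γ .top A
  | inter {Γ : Ctx} {S₁ S₂ : Srt} {A : Ty} :
      Refines Sg Γ S₁ A → Refines Sg Γ S₂ A → Refines Sg Γ (.inter S₁ S₂) A

/-- `Γ ⊢ L ⊏ K`. -/
inductive ClsRefines (Sg : Sig) : Ctx → Cls → Knd → Prop
  | sort {Γ : Ctx} : ClsRefines Sg Γ .sort .type
  | pi {Γ : Ctx} {S : Srt} {A : Ty} {L : Cls} {K : Knd} :
      Refines Sg Γ S A → ClsRefines Sg ((S, A) :: Γ) L K →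
      ClsRefines Sg Γ (.pi S A L) (.pi A K)
  | top {Γ : Ctx} {K : Knd} : ClsRefines Sg Γ .top K
  | inter {Γ : Ctx} {L₁ L₂ : Cls} {K : Knd} :
      ClsRefines Sg Γ L₁ K → ClsRefines Sg Γ L₂ K → ClsRefines Sg Γ (.inter L₁ L₂) K

/-! ### Well-formed signatures and contexts -/

/-- `Σ sig`. -/
inductive SigOK : Sig → Prop
  | nil : SigOK []
  | tyConst {Sg : Sig} {a : ℕ} {K : Knd} :
      SigOK Sg → KndOK Sg [] K → (∀ K', Decl.tyConst a K' ∉ Sg) →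
      SigOK (.tyConst a K :: Sg)
  | tmConst {Sg : Sig} {c : ℕ} {A : Ty} :
      SigOK Sg → TyOK Sg [] A → (∀ A', Decl.tmConst c A' ∉ Sg) →
      SigOK (.tmConst c A :: Sg)
  | srtConst {Sg : Sig} {s a : ℕ} {L : Cls} {K : Knd} :
      SigOK Sg → Decl.tyConst a K ∈ Sg → ClsRefines Sg [] L K →
      (∀ a' L', Decl.srtConst s a' L' ∉ Sg) → SigOK (.srtConst s a L :: Sg)
  | tmSrt {Sg : Sig} {c : ℕ} {A : Ty} {S : Srt} :
      SigOK Sg → Decl.tmConst c A ∈ Sg → Refines Sg [] S A →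
      (∀ S', Decl.tmSrt c S' ∉ Sg) → SigOK (.tmSrt c S :: Sg)
  | subsort {Sg : Sig} {s₁ s₂ a : ℕ} {L : Cls} :
      SigOK Sg → Decl.srtConst s₁ a L ∈ Sg → Decl.srtConst s₂ a L ∈ Sg →
      SigOK (.subsort s₁ s₂ :: Sg)

/-- `Γ ctx`: every declared sort refines its declared type, which is a well-formed LF type. -/
inductive CtxOK (Sg : Sig) : Ctx → Prop
  | nil : CtxOK Sg []
  | cons {Γ : Ctx} {S : Srt} {A : Ty} :
      CtxOK Sg Γ → TyOK Sg Γ.erase A → Refines Sg Γ S A → CtxOK Sg ((S, A) :: Γ)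

/-! ### Declarative subsorting at higher sorts -/

/-- `DeclSub Sg Γ S T A` is `Γ ⊢ S ≤ T ⊏ A`, declarative subsorting between sorts refining `A`.
The `Refines` premises are exactly what is needed for both sides of every derivable judgment
to refine `A` in `Γ`, so that only well-formed sorts occur in derivations.  Forgetting these
premises and the indices `Γ` and `A` turns a derivation into one of the bare rules for `S ≤ T`. -/
inductive DeclSub (Sg : Sig) : Ctx → Srt → Srt → Ty → Prop
  | atomic {Γ : Ctx} {Q₁ Q₂ : AtomSrt} {P : AtomTy} :
      Refines Sg Γ (.atom Q₁) (.atom P) → Refines Sg Γ (.atom Q₂) (.atom P) →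
      AtomSub Sg Q₁ Q₂ → DeclSub Sg Γ (.atom Q₁) (.atom Q₂) (.atom P)
  | refl {Γ : Ctx} {S : Srt} {A : Ty} :
      Refines Sg Γ S A → DeclSub Sg Γ S S A
  | trans {Γ : Ctx} {S₁ S₂ S₃ : Srt} {A : Ty} :
      DeclSub Sg Γ S₁ S₂ A → DeclSub Sg Γ S₂ S₃ A → DeclSub Sg Γ S₁ S₃ A
  | pi {Γ : Ctx} {S₁ S₂ T₁ T₂ : Srt} {A A' : Ty} :
      Refines Sg ((S₁, A) :: Γ) T₁ A' →
      DeclSub Sg Γ S₂ S₁ A → DeclSub Sg ((S₂, A) :: Γ) T₁ T₂ A' →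
      DeclSub Sg Γ (.pi S₁ A T₁) (.pi S₂ A T₂) (.pi A A')
  | topR {Γ : Ctx} {S : Srt} {A : Ty} :
      Refines Sg Γ S A → DeclSub Sg Γ S .top A
  | interR {Γ : Ctx} {S₁ S₂ T : Srt} {A : Ty} :
      DeclSub Sg Γ T S₁ A → DeclSub Sg Γ T S₂ A → DeclSub Sg Γ T (.inter S₁ S₂) A
  | interL₁ {Γ : Ctx} {S₁ S₂ T : Srt} {A : Ty} :
      Refines Sg Γ S₂ A → DeclSub Sg Γ S₁ T A → DeclSub Sg Γ (.inter S₁ S₂) T A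
  | interL₂ {Γ : Ctx} {S₁ S₂ T : Srt} {A : Ty} :
      Refines Sg Γ S₁ A → DeclSub Sg Γ S₂ T A → DeclSub Sg Γ (.inter S₁ S₂) T A
  | topPi {Γ : Ctx} {S : Srt} {A A' : Ty} :
      Refines Sg Γ S A → DeclSub Sg Γ .top (.pi S A .top) (.pi A A')
  | interPi {Γ : Ctx} {S T₁ T₂ : Srt} {A A' : Ty} :
      Refines Sg Γ S A → Refines Sg ((S, A) :: Γ) T₁ A' → Refines Sg ((S, A) :: Γ) T₂ A' →
      DeclSub Sg Γ (.inter (.pi S A T₁) (.pi S A T₂)) (.pi S A (.inter T₁ T₂)) (.pi A A')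

end LFR

namespace LFR

/-! ### Renaming algebra -/

-- At a base type the η-expansion of x is x itself, and checking it is atomic subsorting from a
-- component of the sort of x. At a function type it is λy. η(x η(y)). Checking this against Π U. T
-- asks, under y::U, which sorts x η(y) synthesizes: for each component Π S. T' of the sort of x
-- such that η(y) checks against S, the components of [η(y)/·] T'. The premise on η(y) is
-- recursively the question U ≤ S, and substituting η(y) only renames (`HSubS.eta_var`). So checking
-- unwinds, by `SortCheck.algSub`, into a context-free relation `AlgSub α Δ T` saying that the
-- intersection of Δ lies below T. For a product on the right it gathers the codomains of all
-- components in Δ whose domains lie above U.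
--
-- `AlgSub.declSub` turns this relation into declarative derivations. Finitely many members of Δ
-- suffice. Contravariance moves each of their domains to U, the distributivity rules for ⊤ and ∧
-- merge the codomains, and covariance finishes.
--
-- The obstacle is well-formedness: T' refines its type under y::S, while the derivation needs this
-- under y::U. Hence refinement must be stable under replacing a declared sort by an algorithmic
-- subsort (`Refines.narrow`). This rests on `subsumption`: a term that checks against every sort in
-- Δ checks against T. Subsumption and narrowing are proved together by induction on the size of the
-- simple type.
--
-- Throughout, dependencies are erased to simple types. Hereditary substitution is total on simply
-- typed terms (`substTotal`), which keeps the shapes of synthesized sorts under control and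
-- supplies the substitutions that new applications require.

theorem upRen_id : upRen id = id := by
  funext i; cases i <;> rfl

theorem upRen_comp (f g : ℕ → ℕ) : upRen g ∘ upRen f = upRen (g ∘ f) := by
  funext i; cases i <;> rfl

mutual
theorem Atom.ren_ren (f g : ℕ → ℕ) : ∀ R : Atom, (R.ren f).ren g = R.ren (g ∘ f)
  | .const _ => rfl
  | .var _ => rfl
  | .app R N => by simp only [Atom.ren, Atom.ren_ren f g R, Norm.ren_ren f g N]
theorem Norm.ren_ren (f g : ℕ → ℕ) : ∀ N : Norm, (N.ren f).ren g = N.ren (g ∘ f)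
  | .atom R => by simp only [Norm.ren, Atom.ren_ren f g R]
  | .lam N => by simp only [Norm.ren, Norm.ren_ren _ _ N, upRen_comp]
end

mutual
theorem Atom.ren_id : ∀ R : Atom, R.ren id = R
  | .const _ => rfl
  | .var _ => rfl
  | .app R N => by simp only [Atom.ren, Atom.ren_id R, Norm.ren_id N]
theorem Norm.ren_id : ∀ N : Norm, N.ren id = N
  | .atom R => by simp only [Norm.ren, Atom.ren_id R]
  | .lam N => by simp only [Norm.ren, upRen_id, Norm.ren_id N]
end

theorem AtomTy.ren_ren (f g : ℕ → ℕ) (P : AtomTy) : (P.ren f).ren g = P.ren (g ∘ f) := by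
  induction P with
  | const => rfl
  | app P N ih => simp only [AtomTy.ren, ih, Norm.ren_ren]

theorem Ty.ren_ren (f g : ℕ → ℕ) (A : Ty) : (A.ren f).ren g = A.ren (g ∘ f) := by
  induction A generalizing f g with
  | atom P => simp only [Ty.ren, AtomTy.ren_ren]
  | pi A B ihA ihB => simp only [Ty.ren, ihA, ihB, upRen_comp]

theorem AtomSrt.ren_ren (f g : ℕ → ℕ) (Q : AtomSrt) : (Q.ren f).ren g = Q.ren (g ∘ f) := by
  induction Q with
  | const => rfl
  | app Q N ih => simp only [AtomSrt.ren, ih, Norm.ren_ren]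

theorem Srt.ren_ren (f g : ℕ → ℕ) (S : Srt) : (S.ren f).ren g = S.ren (g ∘ f) := by
  induction S generalizing f g with
  | atom Q => simp only [Srt.ren, AtomSrt.ren_ren]
  | pi S A T ihS ihT => simp only [Srt.ren, ihS, ihT, Ty.ren_ren, upRen_comp]
  | top => rfl
  | inter S T ihS ihT => simp only [Srt.ren, ihS, ihT]

theorem AtomTy.ren_id (P : AtomTy) : P.ren id = P := by
  induction P with
  | const => rfl
  | app P N ih => simp only [AtomTy.ren, ih, Norm.ren_id]

theorem Ty.ren_id (A : Ty) : A.ren id = A := by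
  induction A with
  | atom P => simp only [Ty.ren, AtomTy.ren_id]
  | pi A B ihA ihB => simp only [Ty.ren, upRen_id, ihA, ihB]

theorem AtomSrt.ren_id (Q : AtomSrt) : Q.ren id = Q := by
  induction Q with
  | const => rfl
  | app Q N ih => simp only [AtomSrt.ren, ih, Norm.ren_id]

theorem Srt.ren_id (S : Srt) : S.ren id = S := by
  induction S with
  | atom Q => simp only [Srt.ren, AtomSrt.ren_id]
  | pi S A T ihS ihT => simp only [Srt.ren, upRen_id, ihS, ihT, Ty.ren_id]
  | top => rfl
  | inter S T ihS ihT => simp only [Srt.ren, ihS, ihT]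

theorem AtomTy.erase_ren (ξ : ℕ → ℕ) (P : AtomTy) : (P.ren ξ).erase = P.erase := by
  induction P with
  | const => rfl
  | app P N ih => exact ih

theorem Ty.erase_ren (ξ : ℕ → ℕ) (A : Ty) : (A.ren ξ).erase = A.erase := by
  induction A generalizing ξ with
  | atom P => exact P.erase_ren ξ
  | pi A B ihA ihB => simp only [Ty.ren, Ty.erase, ihA, ihB]

theorem eta_ren (α : STy) (ξ : ℕ → ℕ) (R : Atom) : (eta α R).ren ξ = eta α (R.ren ξ) := by
  induction α generalizing ξ R with
  | base => rfl
  | arr α β ihα ihβ =>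
    simp only [eta, Norm.ren, ihβ, Atom.ren, ihα, upRen, Atom.shift, Atom.ren_ren]
    rfl

/-- The embedding of indices that omits `k`. -/
def skip (k i : ℕ) : ℕ := if i < k then i else i + 1

theorem skip_zero : skip 0 = Nat.succ := by
  funext i; simp [skip]

theorem upRen_skip (k : ℕ) : upRen (skip k) = skip (k + 1) := by
  funext i
  cases i with
  | zero => simp [upRen, skip]
  | succ i => simp only [upRen, skip]; split_ifs <;> omega

theorem skip_ne (k i : ℕ) : skip k i ≠ k := by
  unfold skip; split_ifs <;> omega

theorem skip_injective (k : ℕ) : Function.Injective (skip k) := by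
  intro i j h; unfold skip at h; split_ifs at h <;> omega

theorem exists_skip_eq {k i : ℕ} (h : i ≠ k) : ∃ j, skip k j = i := by
  rcases lt_or_gt_of_ne h with h | h
  · exact ⟨i, by simp [skip, h]⟩
  · exact ⟨i - 1, by unfold skip; split_ifs <;> omega⟩

/-- The renaming that replaces index `k` by `j` and lowers the indices above `k`. -/
def instRen (k j i : ℕ) : ℕ := if i < k then i else if i = k then j else i - 1

theorem upRen_instRen (k j : ℕ) : upRen (instRen k j) = instRen (k + 1) (j + 1) := by
  funext i
  cases i with
  | zero => simp [upRen, instRen]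
  | succ i => simp only [upRen, instRen]; split_ifs <;> omega

theorem instRen_self (k j : ℕ) : instRen k j k = j := by simp [instRen]

theorem instRen_skip (k j i : ℕ) : instRen k j (skip k i) = i := by
  unfold instRen skip; split_ifs <;> omega

/-! ### Hereditary substitution is a partial function -/

theorem HSubRR.var_iff {k : ℕ} {N₀ : Norm} {α₀ : STy} {i : ℕ} {R' : Atom} :
    HSubRR k N₀ α₀ (.var i) R' ↔ ∃ j, i = skip k j ∧ R' = .var j := by
  constructor
  · intro h
    cases h with
    | varLt h => exact ⟨i, by simp [skip, h], rfl⟩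
    | @varGt _ _ _ i h => exact ⟨i, by simp [skip, h], rfl⟩
  · rintro ⟨j, rfl, rfl⟩
    unfold skip
    split_ifs with h
    · exact .varLt h
    · exact .varGt (by omega)

theorem HSubRR.not_hSubRN {k : ℕ} {N₀ : Norm} {α₀ : STy} :
    ∀ {R R' : Atom} {N : Norm} {α : STy}, HSubRR k N₀ α₀ R R' → ¬ HSubRN k N₀ α₀ R N α
  | .const _, _, _, _, _, h => nomatch h
  | .var i, _, _, _, h, h' => by
    obtain ⟨j, rfl, -⟩ := HSubRR.var_iff.1 h
    generalize hk : skip k j = i at h'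
    cases h'
    exact skip_ne _ _ hk
  | .app _ _, _, _, _, .app h _, .beta h' _ _ => h.not_hSubRN h'

mutual
theorem HSubN.functional : ∀ {k : ℕ} {N₀ : Norm} {α₀ : STy} {N V W : Norm},
    HSubN k N₀ α₀ N V → HSubN k N₀ α₀ N W → V = W
  | _, _, _, _, _, _, .atomNorm h, .atomNorm h' => (h.functional h').1
  | _, _, _, _, _, _, .atomNorm h, .atom h' => absurd h h'.not_hSubRN
  | _, _, _, _, _, _, .atom h, .atomNorm h' => absurd h' h.not_hSubRN
  | _, _, _, _, _, _, .atom h, .atom h' => by rw [h.functional h']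
  | _, _, _, _, _, _, .lam h, .lam h' => by rw [h.functional h']
theorem HSubRR.functional : ∀ {k : ℕ} {N₀ : Norm} {α₀ : STy} {R V W : Atom},
    HSubRR k N₀ α₀ R V → HSubRR k N₀ α₀ R W → V = W
  | _, _, _, _, _, _, .varLt _, .varLt _ => rfl
  | _, _, _, _, _, _, .varGt _, .varGt _ => rfl
  | _, _, _, _, _, _, .varLt h, .varGt h' => by omega
  | _, _, _, _, _, _, .varGt h, .varLt h' => by omega
  | _, _, _, _, _, _, .const, .const => rfl
  | _, _, _, _, _, _, .app h g, .app h' g' => by rw [h.functional h', g.functional g']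
theorem HSubRN.functional : ∀ {k : ℕ} {N₀ : Norm} {α₀ : STy} {R : Atom} {V W : Norm} {α β : STy},
    HSubRN k N₀ α₀ R V α → HSubRN k N₀ α₀ R W β → V = W ∧ α = β
  | _, _, _, _, _, _, _, _, .var, .var => ⟨rfl, rfl⟩
  | _, _, _, _, _, _, _, _, .beta h₁ h₂ h₃, .beta h₁' h₂' h₃' => by
    obtain ⟨e, e'⟩ := h₁.functional h₁'
    cases e; cases e'
    cases h₂.functional h₂'
    exact ⟨h₃.functional h₃', rfl⟩
end

theorem HSubP.functional {k : ℕ} {N₀ : Norm} {α₀ : STy} {P V W : AtomTy}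
    (h : HSubP k N₀ α₀ P V) (h' : HSubP k N₀ α₀ P W) : V = W := by
  induction h generalizing W with
  | const => cases h'; rfl
  | app _ g ih => cases h' with | app h' g' => rw [ih h', g.functional g']

theorem HSubA.functional {k : ℕ} {N₀ : Norm} {α₀ : STy} {A V W : Ty}
    (h : HSubA k N₀ α₀ A V) (h' : HSubA k N₀ α₀ A W) : V = W := by
  induction h generalizing W with
  | atom h => cases h' with | atom h' => rw [h.functional h']
  | pi _ _ ih₁ ih₂ => cases h' with | pi h₁ h₂ => rw [ih₁ h₁, ih₂ h₂]

theorem HSubQ.functional {k : ℕ} {N₀ : Norm} {α₀ : STy} {Q V W : AtomSrt}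
    (h : HSubQ k N₀ α₀ Q V) (h' : HSubQ k N₀ α₀ Q W) : V = W := by
  induction h generalizing W with
  | const => cases h'; rfl
  | app _ g ih => cases h' with | app h' g' => rw [ih h', g.functional g']

theorem HSubS.functional {k : ℕ} {N₀ : Norm} {α₀ : STy} {S V W : Srt}
    (h : HSubS k N₀ α₀ S V) (h' : HSubS k N₀ α₀ S W) : V = W := by
  induction h generalizing W with
  | atom h => cases h' with | atom h' => rw [h.functional h']
  | pi _ g _ ih₁ ih₂ => cases h' with | pi h₁ g' h₂ => rw [ih₁ h₁, g.functional g', ih₂ h₂]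
  | top => cases h'; rfl
  | inter _ _ ih₁ ih₂ => cases h' with | inter h₁ h₂ => rw [ih₁ h₁, ih₂ h₂]

theorem HSubL.functional {k : ℕ} {N₀ : Norm} {α₀ : STy} {L V W : Cls}
    (h : HSubL k N₀ α₀ L V) (h' : HSubL k N₀ α₀ L W) : V = W := by
  induction h generalizing W with
  | sort => cases h'; rfl
  | pi h g _ ih => cases h' with | pi h' g' h₂ => rw [h.functional h', g.functional g', ih h₂]
  | top => cases h'; rfl
  | inter _ _ ih₁ ih₂ => cases h' with | inter h₁ h₂ => rw [ih₁ h₁, ih₂ h₂]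

theorem HSubP.erase_eq {k : ℕ} {N₀ : Norm} {α₀ : STy} {P P' : AtomTy}
    (h : HSubP k N₀ α₀ P P') : P'.erase = P.erase := by
  induction h with
  | const => rfl
  | app _ _ ih => exact ih

theorem HSubA.erase_eq {k : ℕ} {N₀ : Norm} {α₀ : STy} {A A' : Ty}
    (h : HSubA k N₀ α₀ A A') : A'.erase = A.erase := by
  induction h with
  | atom h => exact h.erase_eq
  | pi _ _ ih₁ ih₂ => simp only [Ty.erase, ih₁, ih₂]

/-! ### Substitution for a variable that does not occur -/

mutual
theorem HSubRR.of_skip (α₀ : STy) : ∀ (k : ℕ) (N₀ : Norm) (R : Atom),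
    HSubRR k N₀ α₀ (R.ren (skip k)) R
  | _, _, .const _ => .const
  | _, _, .var i => HSubRR.var_iff.2 ⟨i, rfl, rfl⟩
  | _, _, .app R N => .app (HSubRR.of_skip α₀ _ _ R) (HSubN.of_skip α₀ _ _ N)
theorem HSubN.of_skip (α₀ : STy) : ∀ (k : ℕ) (N₀ N : Norm), HSubN k N₀ α₀ (N.ren (skip k)) N
  | _, _, .atom R => .atom (HSubRR.of_skip α₀ _ _ R)
  | _, _, .lam N => .lam (by rw [upRen_skip]; exact HSubN.of_skip α₀ _ _ N)
end

theorem HSubP.of_skip (α₀ : STy) (k : ℕ) (N₀ : Norm) (P : AtomTy) :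
    HSubP k N₀ α₀ (P.ren (skip k)) P := by
  induction P with
  | const => exact .const
  | app P N ih => exact .app ih (.of_skip _ _ _ _)

theorem HSubA.of_skip (α₀ : STy) (k : ℕ) (N₀ : Norm) (A : Ty) :
    HSubA k N₀ α₀ (A.ren (skip k)) A := by
  induction A generalizing k N₀ with
  | atom P => exact .atom (.of_skip _ _ _ _)
  | pi A B ihA ihB => exact .pi (ihA _ _) (by rw [upRen_skip]; exact ihB _ _)

theorem HSubQ.of_skip (α₀ : STy) (k : ℕ) (N₀ : Norm) (Q : AtomSrt) :
    HSubQ k N₀ α₀ (Q.ren (skip k)) Q := by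
  induction Q with
  | const => exact .const
  | app Q N ih => exact .app ih (.of_skip _ _ _ _)

theorem HSubS.of_skip (α₀ : STy) (k : ℕ) (N₀ : Norm) (S : Srt) :
    HSubS k N₀ α₀ (S.ren (skip k)) S := by
  induction S generalizing k N₀ with
  | atom Q => exact .atom (.of_skip _ _ _ _)
  | pi S A T ihS ihT =>
    exact .pi (ihS _ _) (.of_skip _ _ _ _) (by rw [upRen_skip]; exact ihT _ _)
  | top => exact .top
  | inter S T ihS ihT => exact .inter (ihS _ _) (ihT _ _)

theorem HSubS.of_shift (α₀ : STy) (N₀ : Norm) (S : Srt) : HSubS 0 N₀ α₀ S.shift S := by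
  have := HSubS.of_skip α₀ 0 N₀ S
  rwa [skip_zero] at this

/-! ### Hereditary substitution reflects renamings -/

/-- `ξ` and `ξ'` are the actions of one renaming without and with the substituted variable,
which has index `k` before and `k'` after the renaming. -/
structure SubstRen (k : ℕ) (ξ : ℕ → ℕ) (k' : ℕ) (ξ' : ℕ → ℕ) : Prop where
  self : ξ' k = k'
  skip : ∀ i, ξ' (skip k i) = LFR.skip k' (ξ i)

theorem SubstRen.up {k k' : ℕ} {ξ ξ' : ℕ → ℕ} (h : SubstRen k ξ k' ξ') :
    SubstRen (k + 1) (upRen ξ) (k' + 1) (upRen ξ') where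
  self := by simp [upRen, h.self]
  skip i := by
    rw [← upRen_skip, ← upRen_skip]
    cases i with
    | zero => rfl
    | succ i => simp [upRen, h.skip]

theorem SubstRen.zero (ξ : ℕ → ℕ) : SubstRen 0 ξ 0 (upRen ξ) where
  self := rfl
  skip i := by rw [skip_zero]; rfl

theorem Norm.shift_ren (ξ : ℕ → ℕ) (N : Norm) : (N.ren ξ).shift = N.shift.ren (upRen ξ) := by
  simp only [Norm.shift, Norm.ren_ren]; rfl

theorem HSubRR.reflect_ren_var {k k' : ℕ} {ξ ξ' : ℕ → ℕ} (hξ : SubstRen k ξ k' ξ') {i : ℕ}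
    {N₀ N₀' : Norm} {α₀ : STy} {R' V' : Atom} (_ : N₀' = N₀.ren ξ)
    (e : R' = (Atom.var i).ren ξ')
    (h : HSubRR k' N₀' α₀ R' V') : ∃ V, V' = V.ren ξ ∧ HSubRR k N₀ α₀ (.var i) V := by
  subst e
  obtain ⟨j, hj, rfl⟩ := HSubRR.var_iff.1 h
  have hi : i ≠ k := by
    rintro rfl
    exact skip_ne _ _ (hj.symm.trans hξ.self)
  obtain ⟨i, rfl⟩ := exists_skip_eq hi
  rw [hξ.skip] at hj
  rw [← skip_injective _ hj]
  exact ⟨.var i, rfl, HSubRR.var_iff.2 ⟨i, rfl, rfl⟩⟩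

mutual
-- Lets shifts be stripped from a given substitution: definedness is inferred before the renaming
-- from definedness after it. The renamed data are tied by equations rather than placed in the
-- indices, so that the derivation can be destructed.
theorem HSubN.reflect_ren : ∀ {k' : ℕ} {N₀' : Norm} {α₀ : STy} {N' V' : Norm},
    HSubN k' N₀' α₀ N' V' → ∀ {k : ℕ} {ξ ξ' : ℕ → ℕ} {N₀ N : Norm}, SubstRen k ξ k' ξ' →
    N₀' = N₀.ren ξ → N' = N.ren ξ' → ∃ V, V' = V.ren ξ ∧ HSubN k N₀ α₀ N V
  | _, _, _, _, _, .atomNorm h, _, _, _, _, .atom R, hξ, e₀, e => by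
    obtain ⟨V, hV, h⟩ := h.reflect_ren hξ e₀ (Norm.atom.inj e)
    cases V with
    | atom V => exact ⟨_, hV, .atomNorm h⟩
    | lam => cases hV
  | _, _, _, _, _, .atom h, _, _, _, _, .atom R, hξ, e₀, e => by
    obtain ⟨V, hV, h⟩ := h.reflect_ren hξ e₀ (Norm.atom.inj e)
    exact ⟨.atom V, by rw [hV]; rfl, .atom h⟩
  | _, _, _, _, _, .lam h, _, _, _, _, .lam N, hξ, e₀, e => by
    obtain ⟨V, hV, h⟩ := h.reflect_ren hξ.up (by rw [e₀, Norm.shift_ren]) (Norm.lam.inj e)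
    exact ⟨.lam V, by rw [hV]; rfl, .lam h⟩
theorem HSubRR.reflect_ren : ∀ {k' : ℕ} {N₀' : Norm} {α₀ : STy} {R' V' : Atom},
    HSubRR k' N₀' α₀ R' V' → ∀ {k : ℕ} {ξ ξ' : ℕ → ℕ} {N₀ : Norm} {R : Atom},
    SubstRen k ξ k' ξ' →
    N₀' = N₀.ren ξ → R' = R.ren ξ' → ∃ V, V' = V.ren ξ ∧ HSubRR k N₀ α₀ R V
  | _, _, _, _, _, .const, _, _, _, _, .const _, _, _, e => by
    cases e; exact ⟨_, rfl, .const⟩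
  | _, _, _, _, _, .app h g, _, _, _, _, .app R N, hξ, e₀, e => by
    obtain ⟨V, hV, h⟩ := h.reflect_ren hξ e₀ (Atom.app.inj e).1
    obtain ⟨W, hW, g⟩ := g.reflect_ren hξ e₀ (Atom.app.inj e).2
    exact ⟨.app V W, by rw [hV, hW]; rfl, .app h g⟩
  | _, _, _, _, _, .varLt h, k, ξ, ξ', _, .var i, hξ, e₀, e => by
    exact HSubRR.reflect_ren_var hξ e₀ e (.varLt h)
  | _, _, _, _, _, .varGt h, k, ξ, ξ', _, .var i, hξ, e₀, e => by
    exact HSubRR.reflect_ren_var hξ e₀ e (.varGt h)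
theorem HSubRN.reflect_ren : ∀ {k' : ℕ} {N₀' : Norm} {α₀ : STy} {R' : Atom} {V' : Norm}
    {α : STy}, HSubRN k' N₀' α₀ R' V' α →
    ∀ {k : ℕ} {ξ ξ' : ℕ → ℕ} {N₀ : Norm} {R : Atom}, SubstRen k ξ k' ξ' →
    N₀' = N₀.ren ξ → R' = R.ren ξ' → ∃ V, V' = V.ren ξ ∧ HSubRN k N₀ α₀ R V α
  | _, _, _, _, _, _, .var, k, ξ, ξ', _, .var i, hξ, e₀, e => by
    by_cases hi : i = k
    · subst hi; exact ⟨_, e₀, .var⟩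
    · obtain ⟨j, rfl⟩ := exists_skip_eq hi
      exact absurd ((hξ.skip j).symm.trans (Atom.var.inj e).symm) (skip_ne _ _)
  | _, _, _, _, _, _, .beta h₁ h₂ h₃, _, _, _, _, .app R N, hξ, e₀, e => by
    obtain ⟨V, hV, h₁⟩ := h₁.reflect_ren hξ e₀ (Atom.app.inj e).1
    obtain ⟨W, hW, h₂⟩ := h₂.reflect_ren hξ e₀ (Atom.app.inj e).2
    cases V with
    | atom => cases hV
    | lam V =>
      obtain ⟨U, hU, h₃⟩ := h₃.reflect_ren (SubstRen.zero _) hW (Norm.lam.inj hV)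
      exact ⟨U, hU, .beta h₁ h₂ h₃⟩
end

/-! ### Substitution of an η-expanded variable

Whenever it is defined, `[η(y)/x]` renames `x` to `y`, and `[N/x] η(x)` is `N`. -/

theorem SubstRen.shift (k : ℕ) : SubstRen k Nat.succ (k + 1) Nat.succ where
  self := rfl
  skip i := by rw [← upRen_skip]; rfl

/-- η-expansion leaves the head of R in place, and the fresh arguments it adds are untouched by the
substitution. So either the head is the substituted variable, or the result is again an η-expansion.
-/
theorem HSubN.eta_cases {γ : STy} : ∀ {k : ℕ} {N₀ : Norm} {α₀ : STy} {R : Atom} {V : Norm},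
    HSubN k N₀ α₀ (eta γ R) V →
    (∃ M β, HSubRN k N₀ α₀ R M β) ∨ ∃ R', HSubRR k N₀ α₀ R R' ∧ V = eta γ R' := by
  induction γ with
  | base a =>
    intro k N₀ α₀ R V h
    cases h with
    | atomNorm h => exact .inl ⟨_, _, h⟩
    | atom h => exact .inr ⟨_, h, rfl⟩
  | arr γ₁ γ₂ ih₁ ih₂ =>
    intro k N₀ α₀ R V h
    cases h with
    | lam h =>
      rcases ih₂ h with ⟨M, β, hR⟩ | ⟨R', hR, rfl⟩
      · cases hR with
        | beta h₁ _ _ =>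
          obtain ⟨M, -, h₁⟩ := h₁.reflect_ren (SubstRen.shift k) rfl rfl
          exact .inl ⟨_, _, h₁⟩
      · cases hR with
        | app hR g =>
          obtain ⟨R', rfl, hR'⟩ := hR.reflect_ren (SubstRen.shift k) rfl rfl
          refine .inr ⟨R', hR', ?_⟩
          rcases ih₁ g with ⟨M, β, hg⟩ | ⟨E, hg, rfl⟩
          · cases hg
          · cases hg
            rfl

/-- Each β-step passes from a function type to its codomain. This bound makes the type of the
substitution triggered by β strictly smaller, and drives every induction on simple types below. -/
theorem HSubRN.sizeOf_le {k : ℕ} {N₀ : Norm} {α₀ : STy} : ∀ {R : Atom} {M : Norm} {β : STy},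
    HSubRN k N₀ α₀ R M β → sizeOf β ≤ sizeOf α₀
  | .var _, _, _, .var => le_rfl
  | .app _ _, _, _, .beta h _ _ => by
    have := h.sizeOf_le
    simp only [STy.arr.sizeOf_spec] at this
    omega

/-- Where it is defined, substitution of `η_α(y)` at type `α` is a renaming. -/
def EtaSubstRen (α : STy) : Prop :=
  ∀ {k j : ℕ} {N V : Norm}, HSubN k (eta α (.var j)) α N V → V = N.ren (instRen k j)

/-- At a function type, R evaluates to some λ. m, and the η-expansion applies it to η(y) for a fresh
y. The resulting β-step substitutes η(y) at a type smaller than `α₀`, hence merely renames the bound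
variable of m to y, and the abstraction is restored. -/
theorem HSubN.eta_head {α₀ : STy} (ha : ∀ γ : STy, sizeOf γ < sizeOf α₀ → EtaSubstRen γ)
    {γ : STy} : ∀ {k : ℕ} {N₀ : Norm} {R : Atom} {M V : Norm},
    HSubN k N₀ α₀ (eta γ R) V → HSubRN k N₀ α₀ R M γ → V = M := by
  induction γ with
  | base a =>
    intro k N₀ R M V h hR
    cases h with
    | atomNorm h => exact (h.functional hR).1
    | atom h => exact absurd hR h.not_hSubRN
  | arr γ₁ γ₂ ih₁ ih₂ =>
    intro k N₀ R M V h hR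
    cases h with
    | @lam _ _ _ _ V h =>
      rcases h.eta_cases with ⟨M', β, h'⟩ | ⟨R', h', -⟩
      · cases h' with
        | beta h₁ h₂ h₃ =>
          have h' := HSubRN.beta h₁ h₂ h₃
          obtain ⟨M₀, e, h₁⟩ := h₁.reflect_ren (SubstRen.shift k) rfl rfl
          obtain ⟨rfl, e'⟩ := h₁.functional hR
          cases e'
          cases M₀ with
          | atom => cases e
          | lam m =>
            cases e
            rcases h₂.eta_cases with ⟨_, _, h₀⟩ | ⟨_, h₀, rfl⟩
            · cases h₀
            · cases h₀
              have hs := hR.sizeOf_le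
              simp only [STy.arr.sizeOf_spec] at hs
              have e := ha γ₁ (by omega) h₃
              rw [Norm.ren_ren] at e
              -- Under the new binder m was weakened beneath its own bound variable; instantiating
              -- that variable with the fresh index 0 undoes the weakening.
              have e' : instRen 0 0 ∘ upRen Nat.succ = id := by
                funext i; cases i <;> rfl
              rw [e', Norm.ren_id] at e
              rw [ih₂ h h', e]
      · cases h' with
        | app h₁ _ =>
          obtain ⟨_, -, h₁⟩ := h₁.reflect_ren (SubstRen.shift k) rfl rfl
          exact absurd hR h₁.not_hSubRN

theorem eta_shift (α : STy) (j : ℕ) : (eta α (.var j)).shift = eta α (.var (j + 1)) :=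
  eta_ren _ _ _

mutual
theorem HSubN.eta_var_aux {α : STy} (ha : ∀ γ : STy, sizeOf γ < sizeOf α → EtaSubstRen γ) :
    ∀ {k j : ℕ} (N : Norm) {N₀ V : Norm}, N₀ = eta α (.var j) → HSubN k N₀ α N V →
      V = N.ren (instRen k j)
  | _, _, .atom R, _, _, e, .atomNorm h => HSubRN.eta_var_aux ha R e h
  | _, _, .atom R, _, _, e, .atom h => congrArg _ (HSubRR.eta_var_aux ha R e h)
  | _, _, .lam N, _, _, e, .lam h => by
    rw [Norm.ren, upRen_instRen, HSubN.eta_var_aux ha N (by rw [e, eta_shift]) h]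
theorem HSubRR.eta_var_aux {α : STy} (ha : ∀ γ : STy, sizeOf γ < sizeOf α → EtaSubstRen γ) :
    ∀ {k j : ℕ} (R : Atom) {N₀ : Norm} {R' : Atom}, N₀ = eta α (.var j) →
      HSubRR k N₀ α R R' → R' = R.ren (instRen k j)
  | _, _, .const _, _, _, _, .const => rfl
  | _, _, .var _, _, _, _, h => by
    obtain ⟨i, rfl, rfl⟩ := HSubRR.var_iff.1 h
    rw [Atom.ren, instRen_skip]
  | _, _, .app R N, _, _, e, .app h g => by
    rw [Atom.ren, HSubRR.eta_var_aux ha R e h, HSubN.eta_var_aux ha N e g]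
-- A term headed by x evaluates to the η-expansion of its renaming. On an application, β substitutes
-- the argument into the body of an η-expansion, which only fills the outermost fresh argument
-- position.
theorem HSubRN.eta_var_aux {α : STy} (ha : ∀ γ : STy, sizeOf γ < sizeOf α → EtaSubstRen γ) :
    ∀ {k j : ℕ} (R : Atom) {N₀ M : Norm} {β : STy}, N₀ = eta α (.var j) →
      HSubRN k N₀ α R M β → M = eta β (R.ren (instRen k j))
  | _, _, .var _, _, _, _, e, .var => by rw [Atom.ren, instRen_self, e]
  | k, j, .app R N, _, M, β, e, .beta (α₂ := α₂) h₁ h₂ h₃ => by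
    have hs := h₁.sizeOf_le
    simp only [STy.arr.sizeOf_spec] at hs
    have e₁ := HSubRN.eta_var_aux ha R e h₁
    have e₂ := HSubN.eta_var_aux ha N e h₂
    subst e₂
    rw [eta] at e₁
    cases e₁
    have hsh : ∀ N₀ : Norm, HSubRR 0 N₀ α₂ (R.ren (instRen k j)).shift (R.ren (instRen k j)) := by
      intro N₀
      have := HSubRR.of_skip α₂ 0 N₀ (R.ren (instRen k j))
      rwa [skip_zero] at this
    -- The head of the shifted R is not index 0, so the first case is impossible. In the second, the
    -- argument η(0) becomes the substituted term by `HSubN.eta_head`.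
    rcases h₃.eta_cases with ⟨_, _, h⟩ | ⟨R', h, rfl⟩
    · cases h with
      | beta h _ _ => exact absurd h (hsh _).not_hSubRN
    · cases h with
      | app h g =>
        cases h.functional (hsh _)
        rw [HSubN.eta_head (fun γ hγ => ha γ (by omega)) g .var, Atom.ren]
end

theorem etaSubstRen (α : STy) : EtaSubstRen α := by
  induction h : sizeOf α using Nat.strong_induction_on generalizing α with
  | _ n ih =>
    subst h
    exact fun h => HSubN.eta_var_aux (fun γ hγ => ih _ hγ γ rfl) _ rfl h

theorem HSubN.eta_var {α : STy} {k j : ℕ} {N V : Norm}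
    (h : HSubN k (eta α (.var j)) α N V) : V = N.ren (instRen k j) := etaSubstRen α h

theorem HSubP.eta_var {α : STy} {k j : ℕ} {P V : AtomTy}
    (h : HSubP k (eta α (.var j)) α P V) : V = P.ren (instRen k j) := by
  induction h with
  | const => rfl
  | app _ g ih => rw [AtomTy.ren, ih, g.eta_var]

theorem HSubA.eta_var {α : STy} : ∀ {k j : ℕ} {A V : Ty},
    HSubA k (eta α (.var j)) α A V → V = A.ren (instRen k j)
  | _, _, .atom _, _, .atom h => by rw [h.eta_var, Ty.ren]
  | _, _, .pi _ _, _, .pi h₁ h₂ => by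
    rw [eta_shift] at h₂
    rw [h₁.eta_var, h₂.eta_var, Ty.ren, upRen_instRen]

theorem HSubQ.eta_var {α : STy} {k j : ℕ} {Q V : AtomSrt}
    (h : HSubQ k (eta α (.var j)) α Q V) : V = Q.ren (instRen k j) := by
  induction h with
  | const => rfl
  | app _ g ih => rw [AtomSrt.ren, ih, g.eta_var]

theorem HSubS.eta_var {α : STy} : ∀ {k j : ℕ} {S V : Srt},
    HSubS k (eta α (.var j)) α S V → V = S.ren (instRen k j)
  | _, _, .atom _, _, .atom h => by rw [h.eta_var, Srt.ren]
  | _, _, .pi _ _ _, _, .pi h₁ g h₂ => by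
    rw [eta_shift] at h₂
    rw [h₁.eta_var, g.eta_var, h₂.eta_var, Srt.ren, upRen_instRen]
  | _, _, .top, _, .top => rfl
  | _, _, .inter _ _, _, .inter h₁ h₂ => by rw [h₁.eta_var, h₂.eta_var, Srt.ren]

/-! ### Simple typing

Erasing dependencies leaves a simple type discipline, which guarantees that hereditary
substitutions exist. -/

mutual
/-- The atomic term `R` has simple type `α`. -/
inductive SAtom (Sg : Sig) : List STy → Atom → STy → Prop
  | var {D : List STy} {i : ℕ} {α : STy} : D[i]? = some α → SAtom Sg D (.var i) α
  | const {D : List STy} {c : ℕ} {A : Ty} :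
      Decl.tmConst c A ∈ Sg → SAtom Sg D (.const c) A.erase
  | app {D : List STy} {R : Atom} {N : Norm} {α β : STy} :
      SAtom Sg D R (.arr α β) → SNorm Sg D N α → SAtom Sg D (.app R N) β
/-- The normal term `N` is η-long of simple type `α`. -/
inductive SNorm (Sg : Sig) : List STy → Norm → STy → Prop
  | atom {D : List STy} {R : Atom} {a : ℕ} :
      SAtom Sg D R (.base a) → SNorm Sg D (.atom R) (.base a)
  | lam {D : List STy} {N : Norm} {α β : STy} :
      SNorm Sg (α :: D) N β → SNorm Sg D (.lam N) (.arr α β)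
end

def Knd.erase : Knd → List STy
  | .type => []
  | .pi A K => A.erase :: K.erase

/-- The atomic type `P` has simple kind `κ`. -/
inductive SAtomTy (Sg : Sig) (D : List STy) : AtomTy → List STy → Prop
  | const {a : ℕ} {K : Knd} : Decl.tyConst a K ∈ Sg → SAtomTy Sg D (.const a) K.erase
  | app {P : AtomTy} {N : Norm} {α : STy} {κ : List STy} :
      SAtomTy Sg D P (α :: κ) → SNorm Sg D N α → SAtomTy Sg D (.app P N) κ

/-- The type `A` is simply well formed. -/
inductive STyOK (Sg : Sig) : List STy → Ty → Prop
  | atom {D : List STy} {P : AtomTy} : SAtomTy Sg D P [] → STyOK Sg D (.atom P)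
  | pi {D : List STy} {A B : Ty} :
      STyOK Sg D A → STyOK Sg (A.erase :: D) B → STyOK Sg D (.pi A B)

/-- The kind `K` is simply well formed. -/
inductive SKndOK (Sg : Sig) : List STy → Knd → Prop
  | type {D : List STy} : SKndOK Sg D .type
  | pi {D : List STy} {A : Ty} {K : Knd} :
      STyOK Sg D A → SKndOK Sg (A.erase :: D) K → SKndOK Sg D (.pi A K)

/-- All arguments of the atomic sort `Q` are simply typable. -/
inductive SAtomSrt (Sg : Sig) (D : List STy) : AtomSrt → Prop
  | const {s : ℕ} : SAtomSrt Sg D (.const s)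
  | app {Q : AtomSrt} {N : Norm} {α : STy} :
      SAtomSrt Sg D Q → SNorm Sg D N α → SAtomSrt Sg D (.app Q N)

/-- The sort `S` is simply well formed and refines the simple type `α`. -/
inductive SRefines (Sg : Sig) : List STy → Srt → STy → Prop
  | atom {D : List STy} {Q : AtomSrt} {a : ℕ} :
      SAtomSrt Sg D Q → SRefines Sg D (.atom Q) (.base a)
  | pi {D : List STy} {S T : Srt} {A : Ty} {β : STy} :
      SRefines Sg D S A.erase → STyOK Sg D A → SRefines Sg (A.erase :: D) T β →
      SRefines Sg D (.pi S A T) (.arr A.erase β)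
  | top {D : List STy} {α : STy} : SRefines Sg D .top α
  | inter {D : List STy} {S₁ S₂ : Srt} {α : STy} :
      SRefines Sg D S₁ α → SRefines Sg D S₂ α → SRefines Sg D (.inter S₁ S₂) α

/-- The class `L` is simply well formed and refines the simple kind `κ`. -/
inductive SClsRefines (Sg : Sig) : List STy → Cls → List STy → Prop
  | sort {D : List STy} : SClsRefines Sg D .sort []
  | pi {D : List STy} {S : Srt} {A : Ty} {L : Cls} {κ : List STy} :
      SRefines Sg D S A.erase → STyOK Sg D A → SClsRefines Sg (A.erase :: D) L κ →
      SClsRefines Sg D (.pi S A L) (A.erase :: κ)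
  | top {D : List STy} {κ : List STy} : SClsRefines Sg D .top κ
  | inter {D : List STy} {L₁ L₂ : Cls} {κ : List STy} :
      SClsRefines Sg D L₁ κ → SClsRefines Sg D L₂ κ → SClsRefines Sg D (.inter L₁ L₂) κ

theorem SRefines.pi_inv {Sg : Sig} {D : List STy} {S T : Srt} {A : Ty} {α β : STy}
    (h : SRefines Sg D (.pi S A T) (.arr α β)) :
    A.erase = α ∧ SRefines Sg D S α ∧ STyOK Sg D A ∧ SRefines Sg (α :: D) T β := by
  cases h with | pi h₁ h₂ h₃ => exact ⟨rfl, h₁, h₂, h₃⟩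

/-! #### Renaming and weakening -/

/-- `ξ` maps the variables of `D` to variables of `D'` of the same simple type. -/
def RenOK (ξ : ℕ → ℕ) (D D' : List STy) : Prop :=
  ∀ i α, D[i]? = some α → D'[ξ i]? = some α

theorem RenOK.up {ξ : ℕ → ℕ} {D D' : List STy} (h : RenOK ξ D D') (β : STy) :
    RenOK (upRen ξ) (β :: D) (β :: D') := by
  intro i α hi
  cases i with
  | zero => simpa [upRen] using hi
  | succ i => simpa [upRen] using h i α (by simpa using hi)

theorem RenOK.shift (D : List STy) (β : STy) : RenOK Nat.succ D (β :: D) := by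
  intro i α hi
  simpa using hi

theorem RenOK.nil (ξ : ℕ → ℕ) (D : List STy) : RenOK ξ [] D := by
  intro i α hi
  simp at hi

section Ren
variable {Sg Sg' : Sig}

mutual
theorem SAtom.ren (hs : Sg ⊆ Sg') : ∀ {D D' : List STy} {ξ : ℕ → ℕ} {R : Atom} {α : STy},
    SAtom Sg D R α → RenOK ξ D D' → SAtom Sg' D' (R.ren ξ) α
  | _, _, _, _, _, .var h, hξ => .var (hξ _ _ h)
  | _, _, _, _, _, .const h, _ => .const (hs h)
  | _, _, _, _, _, .app h g, hξ => .app (h.ren hs hξ) (g.ren hs hξ)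
theorem SNorm.ren (hs : Sg ⊆ Sg') : ∀ {D D' : List STy} {ξ : ℕ → ℕ} {N : Norm} {α : STy},
    SNorm Sg D N α → RenOK ξ D D' → SNorm Sg' D' (N.ren ξ) α
  | _, _, _, _, _, .atom h, hξ => .atom (h.ren hs hξ)
  | _, _, _, _, _, .lam h, hξ => .lam (h.ren hs (hξ.up _))
end

theorem SAtomTy.ren (hs : Sg ⊆ Sg') {D D' : List STy} {ξ : ℕ → ℕ} {P : AtomTy} {κ : List STy}
    (h : SAtomTy Sg D P κ) (hξ : RenOK ξ D D') : SAtomTy Sg' D' (P.ren ξ) κ := by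
  induction h with
  | const h => exact .const (hs h)
  | app _ g ih => exact .app ih (g.ren hs hξ)

theorem STyOK.ren (hs : Sg ⊆ Sg') {D D' : List STy} {ξ : ℕ → ℕ} {A : Ty}
    (h : STyOK Sg D A) (hξ : RenOK ξ D D') : STyOK Sg' D' (A.ren ξ) := by
  induction h generalizing D' ξ with
  | atom h => exact .atom (h.ren hs hξ)
  | pi _ _ ih₁ ih₂ => exact .pi (ih₁ hξ) (by rw [Ty.erase_ren]; exact ih₂ (hξ.up _))

theorem SAtomSrt.ren (hs : Sg ⊆ Sg') {D D' : List STy} {ξ : ℕ → ℕ} {Q : AtomSrt}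
    (h : SAtomSrt Sg D Q) (hξ : RenOK ξ D D') : SAtomSrt Sg' D' (Q.ren ξ) := by
  induction h with
  | const => exact .const
  | app _ g ih => exact .app ih (g.ren hs hξ)

theorem SRefines.ren (hs : Sg ⊆ Sg') {D D' : List STy} {ξ : ℕ → ℕ} {S : Srt} {α : STy}
    (h : SRefines Sg D S α) (hξ : RenOK ξ D D') : SRefines Sg' D' (S.ren ξ) α := by
  induction h generalizing D' ξ with
  | atom h => exact .atom (h.ren hs hξ)
  | @pi _ _ _ A _ _ g _ ih₁ ih₂ =>
    rw [← Ty.erase_ren ξ A] at *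
    exact .pi (ih₁ hξ) (g.ren hs hξ) (ih₂ (hξ.up _))
  | top => exact .top
  | inter _ _ ih₁ ih₂ => exact .inter (ih₁ hξ) (ih₂ hξ)

theorem STyOK.mono (hs : Sg ⊆ Sg') {D D' : List STy} {A : Ty}
    (h : STyOK Sg D A) (hD : RenOK id D D') : STyOK Sg' D' A := A.ren_id ▸ h.ren hs hD

theorem SRefines.mono (hs : Sg ⊆ Sg') {D D' : List STy} {S : Srt} {α : STy}
    (h : SRefines Sg D S α) (hD : RenOK id D D') : SRefines Sg' D' S α :=
  S.ren_id ▸ h.ren hs hD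

theorem SKndOK.mono (hs : Sg ⊆ Sg') {D : List STy} {K : Knd}
    (h : SKndOK Sg D K) : SKndOK Sg' D K := by
  induction h with
  | type => exact .type
  | pi h _ ih => exact .pi (h.mono hs fun _ _ h => h) ih

theorem SClsRefines.mono (hs : Sg ⊆ Sg') {D D' : List STy} {L : Cls} {κ : List STy}
    (h : SClsRefines Sg D L κ) (hD : RenOK id D D') : SClsRefines Sg' D' L κ := by
  induction h generalizing D' with
  | sort => exact .sort
  | pi h g _ ih => exact .pi (h.mono hs hD) (g.mono hs hD) (ih (upRen_id ▸ hD.up _))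
  | top => exact .top
  | inter _ _ ih₁ ih₂ => exact .inter (ih₁ hD) (ih₂ hD)

end Ren

/-! #### Existence of hereditary substitutions -/

/-- `D` is `D'` with a variable of type `α` inserted at index `k`. -/
structure Ins (k : ℕ) (α : STy) (D' D : List STy) : Prop where
  self : D[k]? = some α
  skip : ∀ i, D[skip k i]? = D'[i]?

theorem Ins.zero (α : STy) (D : List STy) : Ins 0 α D (α :: D) where
  self := rfl
  skip i := by simp [skip_zero]

theorem Ins.up {k : ℕ} {α : STy} {D' D : List STy} (h : Ins k α D' D) (β : STy) :
    Ins (k + 1) α (β :: D') (β :: D) where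
  self := by simpa using h.self
  skip i := by
    rw [← upRen_skip]
    cases i with
    | zero => rfl
    | succ i => simpa [upRen] using h.skip i

section Subst
variable {Sg : Sig}

theorem SNorm.shift {D : List STy} {N : Norm} {α : STy} (h : SNorm Sg D N α) (β : STy) :
    SNorm Sg (β :: D) N.shift α := h.ren (List.Subset.refl _) (.shift _ _)

theorem SRefines.shift {D : List STy} {S : Srt} {α : STy} (h : SRefines Sg D S α) (β : STy) :
    SRefines Sg (β :: D) S.shift α := h.ren (List.Subset.refl _) (.shift _ _)

/-- Substitution for variables of simple type `α` is total on simply typed terms. -/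
def SubstTotal (Sg : Sig) (α : STy) : Prop :=
  ∀ {k : ℕ} {N₀ : Norm} {D' D : List STy} {N : Norm} {β : STy}, Ins k α D' D →
    SNorm Sg D' N₀ α → SNorm Sg D N β → ∃ V, HSubN k N₀ α N V ∧ SNorm Sg D' V β

mutual
-- Structural recursion on the typing, inside an induction on the size of the substituted type. The
-- value of a function term is a λ because normal terms are η-long, so β can always proceed.
theorem SAtom.exists_hSub_aux {α : STy}
    (hα : ∀ γ : STy, sizeOf γ < sizeOf α → SubstTotal Sg γ) :
    ∀ {k : ℕ} {N₀ : Norm} {D' D : List STy} {R : Atom} {β : STy}, Ins k α D' D →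
    SNorm Sg D' N₀ α → SAtom Sg D R β →
    (∃ R', HSubRR k N₀ α R R' ∧ SAtom Sg D' R' β) ∨
      ∃ M, HSubRN k N₀ α R M β ∧ SNorm Sg D' M β
  | k, N₀, _, _, .var i, β, hD, h₀, .var h => by
    by_cases hi : i = k
    · subst hi
      cases h.symm.trans hD.self
      exact .inr ⟨_, .var, h₀⟩
    · obtain ⟨j, rfl⟩ := exists_skip_eq hi
      exact .inl ⟨_, HSubRR.var_iff.2 ⟨j, rfl, rfl⟩, .var ((hD.skip j).symm.trans h)⟩
  | _, _, _, _, _, _, _, _, .const h => .inl ⟨_, .const, .const h⟩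
  | _, _, _, _, _, _, hD, h₀, .app h g => by
    obtain ⟨N', hN, gN⟩ := SNorm.exists_hSub_aux hα hD h₀ g
    rcases SAtom.exists_hSub_aux hα hD h₀ h with ⟨R', hR, gR⟩ | ⟨M, hM, gM⟩
    · exact .inl ⟨_, .app hR hN, .app gR gN⟩
    · cases gM with
      | lam gM =>
        have hs := hM.sizeOf_le
        simp only [STy.arr.sizeOf_spec] at hs
        obtain ⟨V, hV, gV⟩ := hα _ (by omega) (Ins.zero _ _) gN gM
        exact .inr ⟨V, .beta hM hN hV, gV⟩
theorem SNorm.exists_hSub_aux {α : STy}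
    (hα : ∀ γ : STy, sizeOf γ < sizeOf α → SubstTotal Sg γ) :
    ∀ {k : ℕ} {N₀ : Norm} {D' D : List STy} {N : Norm} {β : STy}, Ins k α D' D →
    SNorm Sg D' N₀ α → SNorm Sg D N β → ∃ V, HSubN k N₀ α N V ∧ SNorm Sg D' V β
  | _, _, _, _, _, _, hD, h₀, .atom h => by
    rcases SAtom.exists_hSub_aux hα hD h₀ h with ⟨R', hR, gR⟩ | ⟨M, hM, gM⟩
    · exact ⟨_, .atom hR, .atom gR⟩
    · cases gM with
      | atom gM => exact ⟨_, .atomNorm hM, .atom gM⟩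
  | _, _, _, _, _, _, hD, h₀, .lam h => by
    obtain ⟨V, hV, gV⟩ := SNorm.exists_hSub_aux hα (hD.up _) (h₀.shift _) h
    exact ⟨_, .lam hV, .lam gV⟩
end

theorem substTotal (α : STy) : SubstTotal Sg α := by
  induction h : sizeOf α using Nat.strong_induction_on generalizing α with
  | _ n ih =>
    subst h
    exact fun hD h₀ h => SNorm.exists_hSub_aux (fun γ hγ => ih _ hγ γ rfl) hD h₀ h

variable {k : ℕ} {N₀ : Norm} {α : STy} {D' D : List STy}

theorem SAtomTy.exists_hSub (hD : Ins k α D' D) (h₀ : SNorm Sg D' N₀ α) {P : AtomTy}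
    {κ : List STy} (h : SAtomTy Sg D P κ) :
    ∃ V, HSubP k N₀ α P V ∧ SAtomTy Sg D' V κ := by
  induction h with
  | const h => exact ⟨_, .const, .const h⟩
  | app _ g ih =>
    obtain ⟨V, h, h'⟩ := ih
    obtain ⟨W, g, g'⟩ := substTotal α hD h₀ g
    exact ⟨_, .app h g, .app h' g'⟩

theorem STyOK.exists_hSub (hD : Ins k α D' D) (h₀ : SNorm Sg D' N₀ α) {A : Ty}
    (h : STyOK Sg D A) : ∃ V, HSubA k N₀ α A V ∧ STyOK Sg D' V := by
  induction h generalizing k N₀ D' with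
  | atom h =>
    obtain ⟨V, h, h'⟩ := h.exists_hSub hD h₀
    exact ⟨_, .atom h, .atom h'⟩
  | pi _ _ ih₁ ih₂ =>
    obtain ⟨V, h, h'⟩ := ih₁ hD h₀
    obtain ⟨W, g, g'⟩ := ih₂ (hD.up _) (h₀.shift _)
    exact ⟨_, .pi h g, .pi h' (h.erase_eq ▸ g')⟩

theorem SAtomSrt.exists_hSub (hD : Ins k α D' D) (h₀ : SNorm Sg D' N₀ α) {Q : AtomSrt}
    (h : SAtomSrt Sg D Q) : ∃ V, HSubQ k N₀ α Q V ∧ SAtomSrt Sg D' V := by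
  induction h with
  | const => exact ⟨_, .const, .const⟩
  | app _ g ih =>
    obtain ⟨V, h, h'⟩ := ih
    obtain ⟨W, g, g'⟩ := substTotal α hD h₀ g
    exact ⟨_, .app h g, .app h' g'⟩

theorem SRefines.exists_hSub (hD : Ins k α D' D) (h₀ : SNorm Sg D' N₀ α) {S : Srt} {β : STy}
    (h : SRefines Sg D S β) : ∃ V, HSubS k N₀ α S V ∧ SRefines Sg D' V β := by
  induction h generalizing k N₀ D' with
  | atom h =>
    obtain ⟨V, h, h'⟩ := h.exists_hSub hD h₀
    exact ⟨_, .atom h, .atom h'⟩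
  | pi _ hA _ ih₁ ih₂ =>
    obtain ⟨V, h, h'⟩ := ih₁ hD h₀
    obtain ⟨B, hB, hB'⟩ := hA.exists_hSub hD h₀
    obtain ⟨W, g, g'⟩ := ih₂ (hD.up _) (h₀.shift _)
    refine ⟨_, .pi h hB g, ?_⟩
    rw [← hB.erase_eq] at *
    exact .pi h' hB' g'
  | top => exact ⟨_, .top, .top⟩
  | inter _ _ ih₁ ih₂ =>
    obtain ⟨V, h, h'⟩ := ih₁ hD h₀
    obtain ⟨W, g, g'⟩ := ih₂ hD h₀
    exact ⟨_, .inter h g, .inter h' g'⟩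

theorem SClsRefines.exists_hSub (hD : Ins k α D' D) (h₀ : SNorm Sg D' N₀ α) {L : Cls}
    {κ : List STy} (h : SClsRefines Sg D L κ) :
    ∃ V, HSubL k N₀ α L V ∧ SClsRefines Sg D' V κ := by
  induction h generalizing k N₀ D' with
  | sort => exact ⟨_, .sort, .sort⟩
  | pi hS hA _ ih =>
    obtain ⟨V, h, h'⟩ := hS.exists_hSub hD h₀
    obtain ⟨B, hB, hB'⟩ := hA.exists_hSub hD h₀
    obtain ⟨W, g, g'⟩ := ih (hD.up _) (h₀.shift _)
    refine ⟨_, .pi h hB g, ?_⟩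
    rw [← hB.erase_eq] at *
    exact .pi h' hB' g'
  | top => exact ⟨_, .top, .top⟩
  | inter _ _ ih₁ ih₂ =>
    obtain ⟨V, h, h'⟩ := ih₁ hD h₀
    obtain ⟨W, g, g'⟩ := ih₂ hD h₀
    exact ⟨_, .inter h g, .inter h' g'⟩

end Subst

/-! #### Simple typing of canonical LF and of refinements -/

section Erase
variable {Sg : Sig}

theorem HSubK.erase_eq {k : ℕ} {N₀ : Norm} {α₀ : STy} {K K' : Knd}
    (h : HSubK k N₀ α₀ K K') : K'.erase = K.erase := by
  induction h with
  | type => rfl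
  | pi h _ ih => simp only [Knd.erase, h.erase_eq, ih]

theorem LookupTy.erase {Γ : List Ty} {i : ℕ} {A : Ty} (h : LookupTy Γ i A) :
    (Γ.map Ty.erase)[i]? = some A.erase := by
  induction h with
  | zero Γ A => simp [Ty.shift, Ty.erase_ren]
  | succ B _ ih => simpa [Ty.shift, Ty.erase_ren] using ih

theorem AtomTy.exists_erase_eq (P : AtomTy) : ∃ a, P.erase = .base a := by
  induction P with
  | const a => exact ⟨a, rfl⟩
  | app _ _ ih => exact ih

mutual
theorem TmSynth.sAtom : ∀ {Γ : List Ty} {R : Atom} {A : Ty}, TmSynth Sg Γ R A →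
    SAtom Sg (Γ.map Ty.erase) R A.erase
  | _, _, _, .var h => .var h.erase
  | _, _, _, .const h => .const h
  | _, _, _, .app h g hs => hs.erase_eq ▸ .app h.sAtom g.sNorm
theorem TmCheck.sNorm : ∀ {Γ : List Ty} {N : Norm} {A : Ty}, TmCheck Sg Γ N A →
    SNorm Sg (Γ.map Ty.erase) N A.erase
  | _, _, .atom P, .switch h => by
    have := h.sAtom
    obtain ⟨a, ha⟩ := P.exists_erase_eq
    simp only [Ty.erase, ha] at this ⊢
    exact .atom this
  | _, _, _, .lam h => .lam h.sNorm
end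

theorem TySynth.sAtomTy {Γ : List Ty} {P : AtomTy} {K : Knd} (h : TySynth Sg Γ P K) :
    SAtomTy Sg (Γ.map Ty.erase) P K.erase := by
  induction h with
  | const h => exact .const h
  | app _ g hs ih => exact hs.erase_eq ▸ .app ih g.sNorm

theorem TyOK.sTyOK {Γ : List Ty} {A : Ty} (h : TyOK Sg Γ A) :
    STyOK Sg (Γ.map Ty.erase) A := by
  induction h with
  | atom h => exact .atom h.sAtomTy
  | pi _ _ ih₁ ih₂ => exact .pi ih₁ ih₂

theorem KndOK.sKndOK {Γ : List Ty} {K : Knd} (h : KndOK Sg Γ K) :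
    SKndOK Sg (Γ.map Ty.erase) K := by
  induction h with
  | type => exact .type
  | pi h _ ih => exact .pi h.sTyOK ih

/-- The simple context underlying an LFR context. -/
def Ctx.simple (Γ : Ctx) : List STy := Γ.map fun d => d.2.erase

theorem Ctx.map_erase_erase (Γ : Ctx) : Γ.erase.map Ty.erase = Γ.simple := by
  simp [Ctx.erase, Ctx.simple]

/-- Q and P carry the same arguments, so their simple typing is read off from P. The sorting
premises could not provide it, since every term checks against ⊤. -/
theorem ClsSynth.sAtomSrt {Γ : Ctx} {Q : AtomSrt} {P : AtomTy} {L : Cls}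
    (h : ClsSynth Sg Γ Q P L) {D : List STy} {κ : List STy} (hP : SAtomTy Sg D P κ) :
    SAtomSrt Sg D Q := by
  induction h generalizing κ with
  | const => exact .const
  | app _ _ _ ih => cases hP with | app hP hN => exact .app (ih hP) hN
  | interE₁ _ ih => exact ih hP
  | interE₂ _ ih => exact ih hP

theorem Refines.sRefines {Γ : Ctx} {S : Srt} {A : Ty} (h : Refines Sg Γ S A)
    (hA : STyOK Sg Γ.simple A) : SRefines Sg Γ.simple S A.erase := by
  induction h with
  | @atom Γ Q P h =>
    cases hA with
    | atom hP =>
      obtain ⟨a, ha⟩ := P.exists_erase_eq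
      rw [Ty.erase, ha]
      exact .atom (h.sAtomSrt hP)
  | pi _ _ ih₁ ih₂ => cases hA with | pi hA hB => exact .pi (ih₁ hA) hA (ih₂ hB)
  | top => exact .top
  | inter _ _ ih₁ ih₂ => exact .inter (ih₁ hA) (ih₂ hA)

theorem ClsRefines.sClsRefines {Γ : Ctx} {L : Cls} {K : Knd} (h : ClsRefines Sg Γ L K)
    (hK : SKndOK Sg Γ.simple K) : SClsRefines Sg Γ.simple L K.erase := by
  induction h with
  | sort => exact .sort
  | pi h _ ih => cases hK with | pi hA hK => exact .pi (h.sRefines hA) hA (ih hK)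
  | top => exact .top
  | inter _ _ ih₁ ih₂ => exact .inter (ih₁ hK) (ih₂ hK)

end Erase

/-- What a well-formed signature provides for simple typing. -/
structure SigSimple (Sg : Sig) : Prop where
  tmConst_unique : ∀ {c A B}, Decl.tmConst c A ∈ Sg → Decl.tmConst c B ∈ Sg → A = B
  tyConst_unique : ∀ {a K K'}, Decl.tyConst a K ∈ Sg → Decl.tyConst a K' ∈ Sg → K = K'
  tmConst_ok : ∀ {c A}, Decl.tmConst c A ∈ Sg → STyOK Sg [] A
  tyConst_ok : ∀ {a K}, Decl.tyConst a K ∈ Sg → SKndOK Sg [] K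
  tmSrt_ok : ∀ {c S}, Decl.tmSrt c S ∈ Sg → ∃ A, Decl.tmConst c A ∈ Sg ∧ SRefines Sg [] S A.erase
  srtConst_ok : ∀ {s a L}, Decl.srtConst s a L ∈ Sg →
    ∃ K, Decl.tyConst a K ∈ Sg ∧ SClsRefines Sg [] L K.erase

theorem SigSimple.cons {Sg : Sig} (ih : SigSimple Sg) (d : Decl)
    (h₁ : ∀ c A, d = .tmConst c A → STyOK Sg [] A ∧ ∀ B, Decl.tmConst c B ∉ Sg)
    (h₂ : ∀ a K, d = .tyConst a K → SKndOK Sg [] K ∧ ∀ K', Decl.tyConst a K' ∉ Sg)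
    (h₃ : ∀ c S, d = .tmSrt c S → ∃ A, Decl.tmConst c A ∈ Sg ∧ SRefines Sg [] S A.erase)
    (h₄ : ∀ s a L, d = .srtConst s a L →
      ∃ K, Decl.tyConst a K ∈ Sg ∧ SClsRefines Sg [] L K.erase) :
    SigSimple (d :: Sg) := by
  have hs : Sg ⊆ d :: Sg := List.subset_cons_self _ _
  refine ⟨?_, ?_, ?_, ?_, ?_, ?_⟩
  · intro c A B hA hB
    rcases List.mem_cons.1 hA with hA | hA <;> rcases List.mem_cons.1 hB with hB | hB
    · cases hA.trans hB.symm; rfl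
    · exact absurd hB ((h₁ _ _ hA.symm).2 _)
    · exact absurd hA ((h₁ _ _ hB.symm).2 _)
    · exact ih.tmConst_unique hA hB
  · intro a K K' hK hK'
    rcases List.mem_cons.1 hK with hK | hK <;> rcases List.mem_cons.1 hK' with hK' | hK'
    · cases hK.trans hK'.symm; rfl
    · exact absurd hK' ((h₂ _ _ hK.symm).2 _)
    · exact absurd hK ((h₂ _ _ hK'.symm).2 _)
    · exact ih.tyConst_unique hK hK'
  · intro c A h
    have : STyOK Sg [] A := by
      rcases List.mem_cons.1 h with h | h
      exacts [(h₁ _ _ h.symm).1, ih.tmConst_ok h]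
    exact this.mono hs (.nil _ _)
  · intro a K h
    have : SKndOK Sg [] K := by
      rcases List.mem_cons.1 h with h | h
      exacts [(h₂ _ _ h.symm).1, ih.tyConst_ok h]
    exact this.mono hs
  · intro c S h
    obtain ⟨A, hA, hS⟩ : ∃ A, Decl.tmConst c A ∈ Sg ∧ SRefines Sg [] S A.erase := by
      rcases List.mem_cons.1 h with h | h
      exacts [h₃ _ _ h.symm, ih.tmSrt_ok h]
    exact ⟨A, hs hA, hS.mono hs (.nil _ _)⟩
  · intro s a L h
    obtain ⟨K, hK, hL⟩ : ∃ K, Decl.tyConst a K ∈ Sg ∧ SClsRefines Sg [] L K.erase := by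
      rcases List.mem_cons.1 h with h | h
      exacts [h₄ _ _ _ h.symm, ih.srtConst_ok h]
    exact ⟨K, hs hK, hL.mono hs (.nil _ _)⟩

theorem SigOK.sigSimple {Sg : Sig} (h : SigOK Sg) : SigSimple Sg := by
  induction h with
  | nil => constructor <;> intros <;> simp_all
  | tyConst _ hK hu ih =>
    refine ih.cons _ nofun ?_ nofun nofun
    rintro _ _ ⟨⟩
    exact ⟨hK.sKndOK, hu⟩
  | tmConst _ hA hu ih =>
    refine ih.cons _ ?_ nofun nofun nofun
    rintro _ _ ⟨⟩
    exact ⟨hA.sTyOK, hu⟩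
  | srtConst _ ha hL _ ih =>
    refine ih.cons _ nofun nofun nofun ?_
    rintro _ _ _ ⟨⟩
    exact ⟨_, ha, hL.sClsRefines (ih.tyConst_ok ha)⟩
  | tmSrt _ hc hS _ ih =>
    refine ih.cons _ nofun nofun ?_ nofun
    rintro _ _ ⟨⟩
    exact ⟨_, hc, hS.sRefines (ih.tmConst_ok hc)⟩
  | subsort _ _ _ ih => exact ih.cons _ nofun nofun nofun nofun

/-- Every declared sort refines the erasure of its declared type. -/
inductive SCtxOK (Sg : Sig) : Ctx → Prop
  | nil : SCtxOK Sg []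
  | cons {Γ : Ctx} {S : Srt} {A : Ty} :
      SCtxOK Sg Γ → SRefines Sg Γ.simple S A.erase → SCtxOK Sg ((S, A) :: Γ)

section
variable {Sg : Sig}

theorem CtxOK.sCtxOK {Γ : Ctx} (h : CtxOK Sg Γ) : SCtxOK Sg Γ := by
  induction h with
  | nil => exact .nil
  | cons _ hA hS ih => exact .cons ih (hS.sRefines (Ctx.map_erase_erase _ ▸ hA.sTyOK))

theorem SCtxOK.lookup {Γ : Ctx} (hΓ : SCtxOK Sg Γ) {i : ℕ} {S : Srt} (h : Lookup Γ i S)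
    {α : STy} (hα : Γ.simple[i]? = some α) : SRefines Sg Γ.simple S α := by
  induction h with
  | zero Γ S A =>
    cases hα
    cases hΓ with | cons _ hS => exact hS.shift _
  | succ d h ih =>
    cases hΓ with | cons hΓ _ => exact (ih hΓ hα).shift _

/-- Simple typability of R has to be assumed, because a domain sort ⊤ accepts arbitrary arguments.
In the application case totality gives a well-formed instance of the codomain, and functionality
identifies it with the synthesized one. -/
theorem SortSynth.sRefines (hSg : SigSimple Sg) : ∀ {Γ : Ctx} {R : Atom} {S : Srt},
    SortSynth Sg Γ R S → SCtxOK Sg Γ → ∀ {α : STy}, SAtom Sg Γ.simple R α →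
    SRefines Sg Γ.simple S α
  | _, _, _, .const h, _, _, hR => by
    cases hR with
    | const hc =>
      obtain ⟨A, hA, hS⟩ := hSg.tmSrt_ok h
      cases hSg.tmConst_unique hA hc
      exact hS.mono (List.Subset.refl _) (.nil _ _)
  | _, _, _, .var h, hΓ, _, hR => by
    cases hR with | var hi => exact hΓ.lookup h hi
  | _, _, _, .app h _ hs, hΓ, _, hR => by
    cases hR with
    | app hR hN =>
      obtain ⟨rfl, -, -, hT⟩ := (h.sRefines hSg hΓ hR).pi_inv
      obtain ⟨T', h', hT'⟩ := hT.exists_hSub (Ins.zero _ _) hN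
      rwa [hs.functional h']
  | _, _, _, .interE₁ h, hΓ, _, hR => by
    cases h.sRefines hSg hΓ hR with | inter h _ => exact h
  | _, _, _, .interE₂ h, hΓ, _, hR => by
    cases h.sRefines hSg hΓ hR with | inter _ h => exact h

/-! ### Components of a sort -/

/-- `Comp S V`: the sort `V` is obtained from `S` by projections out of intersections. -/
inductive Comp : Srt → Srt → Prop
  | refl {S : Srt} : Comp S S
  | left {S₁ S₂ V : Srt} : Comp S₁ V → Comp (.inter S₁ S₂) V
  | right {S₁ S₂ V : Srt} : Comp S₂ V → Comp (.inter S₁ S₂) V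

theorem Comp.trans {S V W : Srt} (h : Comp S V) (h' : Comp V W) : Comp S W := by
  induction h with
  | refl => exact h'
  | left _ ih => exact .left (ih h')
  | right _ ih => exact .right (ih h')

theorem Comp.of_ren {ξ : ℕ → ℕ} {S V' : Srt} (h : Comp (S.ren ξ) V') :
    ∃ V, V' = V.ren ξ ∧ Comp S V := by
  generalize hS : S.ren ξ = S' at h
  induction h generalizing S with
  | refl => exact ⟨S, hS.symm, .refl⟩
  | left _ ih =>
    cases S <;> cases hS
    obtain ⟨V, hV, h⟩ := ih rfl
    exact ⟨V, hV, .left h⟩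
  | right _ ih =>
    cases S <;> cases hS
    obtain ⟨V, hV, h⟩ := ih rfl
    exact ⟨V, hV, .right h⟩

theorem SortSynth.comp {Γ : Ctx} {R : Atom} {S V : Srt} (h : SortSynth Sg Γ R S)
    (hV : Comp S V) : SortSynth Sg Γ R V := by
  induction hV with
  | refl => exact h
  | left _ ih => exact ih (.interE₁ h)
  | right _ ih => exact ih (.interE₂ h)

theorem SortCheck.comp {Γ : Ctx} {N : Norm} {S V : Srt} (h : SortCheck Sg Γ N S)
    (hV : Comp S V) : SortCheck Sg Γ N V := by
  induction hV with
  | refl => exact h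
  | left _ ih => cases h with | inter h _ => exact ih h
  | right _ ih => cases h with | inter _ h => exact ih h

theorem SRefines.comp {D : List STy} {S V : Srt} {α : STy} (h : SRefines Sg D S α)
    (hV : Comp S V) : SRefines Sg D V α := by
  induction hV with
  | refl => exact h
  | left _ ih => cases h with | inter h _ => exact ih h
  | right _ ih => cases h with | inter _ h => exact ih h

theorem Refines.comp {Γ : Ctx} {S V : Srt} {A : Ty} (h : Refines Sg Γ S A)
    (hV : Comp S V) : Refines Sg Γ V A := by
  induction hV with
  | refl => exact h
  | left _ ih => cases h with | inter h _ => exact ih h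
  | right _ ih => cases h with | inter _ h => exact ih h

/-- Intersection eliminations can follow any synthesis rule; all of them are collected into a single
`Comp`. The same is done for applications below. -/
theorem SortSynth.var_inv : ∀ {Γ : Ctx} {R : Atom} {V : Srt}, SortSynth Sg Γ R V →
    ∀ {i : ℕ}, R = .var i → ∃ S, Lookup Γ i S ∧ Comp S V
  | _, _, _, .var h, _, e => by
    cases e
    exact ⟨_, h, .refl⟩
  | _, _, _, .interE₁ h, _, e => by
    obtain ⟨S, hS, hV⟩ := h.var_inv e
    exact ⟨S, hS, hV.trans (.left .refl)⟩
  | _, _, _, .interE₂ h, _, e => by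
    obtain ⟨S, hS, hV⟩ := h.var_inv e
    exact ⟨S, hS, hV.trans (.right .refl)⟩

theorem SortSynth.app_inv : ∀ {Γ : Ctx} {R' : Atom} {V : Srt}, SortSynth Sg Γ R' V →
    ∀ {R : Atom} {N : Norm}, R' = .app R N → ∃ S A T T', SortSynth Sg Γ R (.pi S A T) ∧
      SortCheck Sg Γ N S ∧ HSubS 0 N A.erase T T' ∧ Comp T' V
  | _, _, _, .app h g hs, _, _, e => by
    cases e
    exact ⟨_, _, _, _, h, g, hs, .refl⟩
  | _, _, _, .interE₁ h, _, _, e => by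
    obtain ⟨S, A, T, T', h, g, hs, hV⟩ := h.app_inv e
    exact ⟨S, A, T, T', h, g, hs, hV.trans (.left .refl)⟩
  | _, _, _, .interE₂ h, _, _, e => by
    obtain ⟨S, A, T, T', h, g, hs, hV⟩ := h.app_inv e
    exact ⟨S, A, T, T', h, g, hs, hV.trans (.right .refl)⟩

/-! ### Algorithmic subsorting -/

theorem AtomSub.trans {Q₁ Q₂ Q₃ : AtomSrt} (h : AtomSub Sg Q₁ Q₂) (h' : AtomSub Sg Q₂ Q₃) :
    AtomSub Sg Q₁ Q₃ := by
  induction h with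
  | refl => exact h'
  | step h _ ih => exact .step h (ih h')

/-- `AlgSub Sg α Δ T`: the intersection of the sorts in `Δ`, which refine the simple type `α`,
is a subsort of `T`.  This relation does not mention contexts. -/
def AlgSub (Sg : Sig) : STy → Set Srt → Srt → Prop
  | _, _, .top => True
  | α, Δ, .inter T₁ T₂ => AlgSub Sg α Δ T₁ ∧ AlgSub Sg α Δ T₂
  | _, Δ, .atom Q => ∃ V ∈ Δ, ∃ Q', Comp V (.atom Q') ∧ AtomSub Sg Q' Q
  | .base _, _, .pi _ _ _ => False
  -- All components applicable to arguments of sort U contribute their codomains simultaneously;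
  -- this is why the left side is a set of sorts. The domains are compared in the opposite
  -- direction, at a smaller simple type.
  | .arr α β, Δ, .pi U _ T =>
    AlgSub Sg β {T' | ∃ V ∈ Δ, ∃ S A, Comp V (.pi S A T') ∧ AlgSub Sg α {U} S} T
termination_by α _ T => (α, T)

/-- An operation on sorts that acts on subterms under binders by its successor operation and is
compatible with atomic subsorting. -/
structure SrtAction (Sg : Sig) {ι : Type} (next : ι → ι) (E : ι → Srt → Srt → Prop) : Prop where
  top : ∀ {n W}, E n .top W → W = .top
  inter : ∀ {n S T W}, E n (.inter S T) W → ∃ S' T', W = .inter S' T' ∧ E n S S' ∧ E n T T'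
  pi : ∀ {n S A T W}, E n (.pi S A T) W →
    ∃ S' A' T', W = .pi S' A' T' ∧ E n S S' ∧ E (next n) T T'
  atom : ∀ {n Q W}, E n (.atom Q) W → ∃ Q', W = .atom Q'
  atomSub : ∀ {n Q₁ Q₂ Q₁' Q₂'}, E n (.atom Q₁) (.atom Q₁') → E n (.atom Q₂) (.atom Q₂') →
    AtomSub Sg Q₁ Q₂ → AtomSub Sg Q₁' Q₂'

theorem Comp.map {ι : Type} {next : ι → ι} {E : ι → Srt → Srt → Prop}
    (hE : SrtAction Sg next E) {n : ι} {S V S' : Srt} (h : Comp S V) (hS : E n S S') :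
    ∃ V', E n V V' ∧ Comp S' V' := by
  induction h generalizing S' with
  | refl => exact ⟨_, hS, .refl⟩
  | left _ ih =>
    obtain ⟨_, _, rfl, h, -⟩ := hE.inter hS
    obtain ⟨V', hV, h⟩ := ih h
    exact ⟨V', hV, .left h⟩
  | right _ ih =>
    obtain ⟨_, _, rfl, -, h⟩ := hE.inter hS
    obtain ⟨V', hV, h⟩ := ih h
    exact ⟨V', hV, .right h⟩

theorem AlgSub.map {ι : Type} {next : ι → ι} {E : ι → Srt → Srt → Prop}
    (hE : SrtAction Sg next E) {α : STy} : ∀ {n : ι} {Δ Δ' : Set Srt} {T T' : Srt},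
    AlgSub Sg α Δ T → (∀ V ∈ Δ, ∃ V' ∈ Δ', E n V V') → E n T T' → AlgSub Sg α Δ' T' := by
  -- The inner induction on T is isolated here with the product case as a hypothesis, which the
  -- outer induction on α then supplies.
  have aux : ∀ (α : STy),
      (∀ {n : ι} {Δ Δ' : Set Srt} {S A T T'}, AlgSub Sg α Δ (.pi S A T) →
        (∀ V ∈ Δ, ∃ V' ∈ Δ', E n V V') → E n (.pi S A T) T' → AlgSub Sg α Δ' T') →
      ∀ {n : ι} {Δ Δ' : Set Srt} {T T' : Srt},
        AlgSub Sg α Δ T → (∀ V ∈ Δ, ∃ V' ∈ Δ', E n V V') → E n T T' → AlgSub Sg α Δ' T' := by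
    intro α hpi n Δ Δ' T T' h hΔ hT
    induction T generalizing T' with
    | top => rw [hE.top hT, AlgSub]; trivial
    | inter T₁ T₂ ih₁ ih₂ =>
      obtain ⟨_, _, rfl, h₁, h₂⟩ := hE.inter hT
      rw [AlgSub] at h ⊢
      exact ⟨ih₁ h.1 h₁, ih₂ h.2 h₂⟩
    | atom Q =>
      obtain ⟨Q₁, rfl⟩ := hE.atom hT
      rw [AlgSub] at h ⊢
      obtain ⟨V, hV, Q', hQ', hs⟩ := h
      obtain ⟨V', hV', hVV'⟩ := hΔ V hV
      obtain ⟨W, hW, hc⟩ := hQ'.map hE hVV'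
      obtain ⟨Q'', rfl⟩ := hE.atom hW
      exact ⟨V', hV', Q'', hc, hE.atomSub hW hT hs⟩
    | pi => exact hpi h hΔ hT
  induction α with
  | base a =>
    intro n Δ Δ' T T'
    refine aux _ fun h _ _ => ?_
    rw [AlgSub] at h
    exact h.elim
  | arr α β ihα ihβ =>
    intro n Δ Δ' T T'
    refine aux _ fun {n Δ Δ' S A T T'} h hΔ hT => ?_
    obtain ⟨U', A', T', rfl, hU, hT⟩ := hE.pi hT
    rw [AlgSub] at h ⊢
    refine ihβ h ?_ hT
    rintro W ⟨V, hV, S₁, A₁, hc, hs⟩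
    obtain ⟨V', hV', hVV'⟩ := hΔ V hV
    obtain ⟨X, hX, hc'⟩ := hc.map hE hVV'
    obtain ⟨S', B', W', rfl, hS, hW⟩ := hE.pi hX
    refine ⟨W', ⟨V', hV', S', B', hc', ihα hs ?_ hS⟩, hW⟩
    rintro _ rfl
    exact ⟨U', rfl, hU⟩

theorem AtomSubStep.ren {ξ : ℕ → ℕ} {Q₁ Q₂ : AtomSrt} (h : AtomSubStep Sg Q₁ Q₂) :
    AtomSubStep Sg (Q₁.ren ξ) (Q₂.ren ξ) := by
  induction h with
  | decl h => exact .decl h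
  | app _ ih => exact .app ih

theorem AtomSub.ren {ξ : ℕ → ℕ} {Q₁ Q₂ : AtomSrt} (h : AtomSub Sg Q₁ Q₂) :
    AtomSub Sg (Q₁.ren ξ) (Q₂.ren ξ) := by
  induction h with
  | refl => exact .refl
  | step h _ ih => exact .step h.ren ih

theorem AtomSubStep.hSub {k : ℕ} {N : Norm} {α : STy} {Q₁ Q₂ Q₁' : AtomSrt}
    (h : AtomSubStep Sg Q₁ Q₂) (h₁ : HSubQ k N α Q₁ Q₁') :
    ∃ Q₂', HSubQ k N α Q₂ Q₂' ∧ AtomSubStep Sg Q₁' Q₂' := by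
  induction h generalizing Q₁' with
  | decl h => cases h₁; exact ⟨_, .const, .decl h⟩
  | app _ ih =>
    cases h₁ with
    | app h₁ hN =>
      obtain ⟨Q, hQ, h⟩ := ih h₁
      exact ⟨_, .app hQ hN, .app h⟩

theorem AtomSub.hSub {k : ℕ} {N : Norm} {α : STy} {Q₁ Q₂ Q₁' Q₂' : AtomSrt}
    (h : AtomSub Sg Q₁ Q₂) (h₁ : HSubQ k N α Q₁ Q₁') (h₂ : HSubQ k N α Q₂ Q₂') :
    AtomSub Sg Q₁' Q₂' := by
  induction h generalizing Q₁' with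
  | refl => rw [h₁.functional h₂]; exact .refl
  | step h _ ih =>
    obtain ⟨Q, hQ, h⟩ := h.hSub h₁
    exact .step h (ih hQ h₂)

theorem SrtAction.ren (Sg : Sig) : SrtAction Sg upRen fun ξ S S' => S' = S.ren ξ where
  top h := h
  inter h := ⟨_, _, h, rfl, rfl⟩
  pi h := ⟨_, _, _, h, rfl, rfl⟩
  atom h := ⟨_, h⟩
  atomSub h₁ h₂ h := by
    cases h₁; cases h₂
    exact h.ren

theorem SrtAction.hSub (Sg : Sig) (α : STy) :
    SrtAction Sg (fun n : ℕ × Norm => (n.1 + 1, n.2.shift)) fun n => HSubS n.1 n.2 α where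
  top h := by cases h; rfl
  inter h := by cases h with | inter h₁ h₂ => exact ⟨_, _, rfl, h₁, h₂⟩
  pi h := by cases h with | pi h₁ _ h₂ => exact ⟨_, _, _, rfl, h₁, h₂⟩
  atom h := by cases h; exact ⟨_, rfl⟩
  atomSub h₁ h₂ h := by
    cases h₁ with | atom h₁ => cases h₂ with | atom h₂ => exact h.hSub h₁ h₂

theorem AlgSub.ren {α : STy} {ξ : ℕ → ℕ} {Δ Δ' : Set Srt} {T : Srt} (h : AlgSub Sg α Δ T)
    (hΔ : ∀ V ∈ Δ, V.ren ξ ∈ Δ') : AlgSub Sg α Δ' (T.ren ξ) :=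
  h.map (SrtAction.ren Sg) (n := ξ) (fun V hV => ⟨_, hΔ V hV, rfl⟩) rfl

theorem AlgSub.mono {α : STy} {Δ Δ' : Set Srt} {T : Srt} (h : AlgSub Sg α Δ T)
    (hΔ : Δ ⊆ Δ') : AlgSub Sg α Δ' T := by
  have := h.ren (ξ := id) (Δ' := Δ') fun V hV => by rw [V.ren_id]; exact hΔ hV
  rwa [T.ren_id] at this

theorem AlgSub.hSub {γ α : STy} {k : ℕ} {N : Norm} {Δ Δ' : Set Srt} {T T' : Srt}
    (h : AlgSub Sg γ Δ T) (hΔ : ∀ V ∈ Δ, ∃ V' ∈ Δ', HSubS k N α V V')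
    (hT : HSubS k N α T T') : AlgSub Sg γ Δ' T' :=
  h.map (SrtAction.hSub Sg α) (n := (k, N)) hΔ hT

/-- Strengthening is obtained by substituting for the absent variable; the substituted term and its
type are irrelevant. -/
theorem AlgSub.of_shift {α : STy} {S T : Srt} (h : AlgSub Sg α {S.shift} T.shift) :
    AlgSub Sg α {S} T := by
  refine h.hSub (α := .base 0) (k := 0) (N := .atom (.var 0)) ?_ (.of_shift _ _ _)
  rintro _ rfl
  exact ⟨S, rfl, .of_shift _ _ _⟩

theorem AlgSub.of_ren_add {α : STy} {S T : Srt} (n : ℕ)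
    (h : AlgSub Sg α {S.ren (· + n)} (T.ren (· + n))) : AlgSub Sg α {S} T := by
  induction n with
  | zero =>
    have e : (fun i : ℕ => i + 0) = id := rfl
    rwa [e, S.ren_id, T.ren_id] at h
  | succ n ih =>
    refine ih (AlgSub.of_shift ?_)
    simp only [Srt.shift, Srt.ren_ren]
    exact h

/-! ### From checking an η-expansion to algorithmic subsorting -/

theorem Lookup.of_append {Γ : Ctx} {S : Srt} {A : Ty} : ∀ {Ξ : Ctx} {V : Srt},
    Lookup (Ξ ++ (S, A) :: Γ) Ξ.length V → V = S.ren (· + (Ξ.length + 1))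
  | [], _, .zero _ _ _ => rfl
  | d :: Ξ, _, .succ _ h => by
    rw [Lookup.of_append h, Srt.shift, Srt.ren_ren]
    rfl

/-- In every extension of `Γ`, the sorts synthesized by `R` are components of sorts in `Δ`. -/
def SynthWithin (Sg : Sig) (Γ : Ctx) (R : Atom) (Δ : Set Srt) : Prop :=
  ∀ (Ξ : Ctx) (V : Srt), SortSynth Sg (Ξ ++ Γ) (R.ren (· + Ξ.length)) V →
    ∃ S ∈ Δ, Comp (S.ren (· + Ξ.length)) V

theorem SynthWithin.var (Sg : Sig) (Γ Ξ : Ctx) (S : Srt) (A : Ty) :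
    SynthWithin Sg (Ξ ++ (S, A) :: Γ) (.var Ξ.length) {S.ren (· + (Ξ.length + 1))} := by
  intro Ξ' V h
  obtain ⟨U, hU, hV⟩ := h.var_inv rfl
  have e : Ξ.length + Ξ'.length = (Ξ' ++ Ξ).length := by rw [List.length_append, Nat.add_comm]
  rw [← List.append_assoc] at hU
  simp only [e] at hU
  refine ⟨_, rfl, ?_⟩
  rw [hU.of_append] at hV
  rw [Srt.ren_ren]
  convert hV using 3
  simp; omega

/-- The padding type `.base 0` is arbitrary, since the added variables do not occur in the renamed
sort. -/
theorem SRefines.ren_add {D : List STy} {S : Srt} {α : STy} (h : SRefines Sg D S α) (n : ℕ) :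
    SRefines Sg (List.replicate n (.base 0) ++ D) (S.ren (· + n)) α := by
  refine h.ren (List.Subset.refl _) fun i β hi => ?_
  rw [List.getElem?_append_right (by simp)]
  simpa using hi

/-- The simple context `D` is independent of Γ: it serves only to force the sorts in Δ and T to have
the shape prescribed by α. Extensions of Γ are built into `SynthWithin` because η-expansion goes
under binders. -/
theorem SortCheck.algSub {Sg : Sig} {α : STy} : ∀ {Γ : Ctx} {R : Atom} {Δ : Set Srt} {T : Srt}
    {D : List STy}, SynthWithin Sg Γ R Δ → (∀ V ∈ Δ, SRefines Sg D V α) → SRefines Sg D T α →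
    SortCheck Sg Γ (eta α R) T → AlgSub Sg α Δ T := by
  induction α with
  | base a =>
    intro Γ R Δ T D hR hΔ hT h
    induction T with
    | top => rw [AlgSub]; trivial
    | inter T₁ T₂ ih₁ ih₂ =>
      cases hT with
      | inter hT₁ hT₂ =>
        cases h with
        | inter h₁ h₂ =>
          rw [AlgSub]
          exact ⟨ih₁ hT₁ h₁, ih₂ hT₂ h₂⟩
    | atom Q =>
      cases h with
      | switch h hs =>
        obtain ⟨S, hS, hV⟩ := hR [] _ (R.ren_id.symm ▸ h)
        rw [AlgSub]
        exact ⟨S, hS, _, S.ren_id ▸ hV, hs⟩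
    | pi => cases hT
  | arr α β ihα ihβ =>
    intro Γ R Δ T D hR hΔ hT h
    induction T with
    | top => rw [AlgSub]; trivial
    | inter T₁ T₂ ih₁ ih₂ =>
      cases hT with
      | inter hT₁ hT₂ =>
        cases h with
        | inter h₁ h₂ =>
          rw [AlgSub]
          exact ⟨ih₁ hT₁ h₁, ih₂ hT₂ h₂⟩
    | atom Q => cases hT
    | pi U A T =>
      obtain ⟨hA, hU, -, hT⟩ := hT.pi_inv
      cases h with
      | lam h =>
        rw [AlgSub]
        refine ihβ (D := α :: D) ?_ ?_ hT h
        · intro Ξ V hV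
          obtain ⟨S', A', T', W, hR', hN, hs, hW⟩ := SortSynth.app_inv hV rfl
          rw [Atom.shift, Atom.ren_ren] at hR'
          -- The extension now includes the variable bound by the λ, whose sort is U.
          obtain ⟨X, hX, hc⟩ := hR (Ξ ++ [(U, A)]) (.pi S' A' T') (by
            have e : (fun i => i + Ξ.length) ∘ Nat.succ = (· + (Ξ ++ [(U, A)]).length) := by
              funext i
              simp only [Function.comp, List.length_append, List.length_singleton]
              omega
            rw [List.append_assoc, ← e]
            exact hR')
          obtain ⟨Y, hY, hc'⟩ := hc.of_ren
          cases Y <;> cases hY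
          rename_i S B T
          obtain ⟨hB, hS, -, -⟩ := ((hΔ X hX).comp hc').pi_inv
          rw [Ty.erase_ren, hB, eta_ren] at hs
          rw [HSubS.eta_var hs, Srt.ren_ren] at hW
          refine ⟨T, ⟨X, hX, S, B, hc', ?_⟩, ?_⟩
          · rw [eta_ren] at hN
            simp only [Atom.ren, Nat.zero_add] at hN
            simp only [List.length_append, List.length_singleton] at hN
            -- The premise on the argument says that the η-expansion of a variable of sort U checks
            -- against S, so the induction hypothesis at the domain type gives U ≤ S.
            refine AlgSub.of_ren_add (Ξ.length + 1)
              (ihα (SynthWithin.var Sg Γ Ξ U A)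
                (D := List.replicate (Ξ.length + 1) (.base 0) ++ D) ?_ ?_ hN)
            · rintro _ rfl
              exact hU.ren_add _
            · exact hS.ren_add _
          -- Instantiating the bound variable of the codomain with the index `Ξ.length` of the
          -- λ-bound variable turns the renaming under a binder into a plain shift by `Ξ.length`.
          · convert hW using 2
            funext i
            cases i with
            | zero => simp [upRen, instRen]
            | succ i => simp [upRen, instRen]; omega
        · rintro V ⟨X, hX, S, B, hc, -⟩
          exact ((hΔ X hX).comp hc).pi_inv.2.2.2
end

/-! ### Subsumption and narrowing -/

section
variable {Sg : Sig}

/-- `CtxSub Sg n Γ' Γ`: the declarations of `Γ'` agree with those of `Γ` up to simple erasure,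
except that sorts at simple types of size at most `n` may be replaced by subsorts. -/
inductive CtxSub (Sg : Sig) (n : ℕ) : Ctx → Ctx → Prop
  | nil : CtxSub Sg n [] []
  | cons {Γ' Γ : Ctx} {S' S : Srt} {A' A : Ty} : CtxSub Sg n Γ' Γ → A'.erase = A.erase →
      (S' = S ∨ sizeOf A.erase ≤ n ∧ AlgSub Sg A.erase {S'} S) →
      CtxSub Sg n ((S', A') :: Γ') ((S, A) :: Γ)

theorem CtxSub.refl (n : ℕ) : ∀ Γ : Ctx, CtxSub Sg n Γ Γ
  | [] => .nil
  | _ :: Γ => .cons (.refl n Γ) rfl (.inl rfl)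

theorem CtxSub.simple_eq {n : ℕ} {Γ' Γ : Ctx} (h : CtxSub Sg n Γ' Γ) :
    Γ'.simple = Γ.simple := by
  induction h with
  | nil => rfl
  | cons _ e _ ih => simpa [Ctx.simple, e] using ih

theorem CtxSub.lookup {n : ℕ} {Γ' Γ : Ctx} (h : CtxSub Sg n Γ' Γ) {i : ℕ} {S : Srt}
    (hi : Lookup Γ i S) {α : STy} (hα : Γ.simple[i]? = some α) :
    Lookup Γ' i S ∨ sizeOf α ≤ n ∧ ∃ S', Lookup Γ' i S' ∧ AlgSub Sg α {S'} S := by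
  induction hi generalizing Γ' with
  | zero Γ S A =>
    cases hα
    cases h with
    | cons _ _ h =>
      rcases h with rfl | ⟨hn, h⟩
      · exact .inl (.zero _ _ _)
      · refine .inr ⟨hn, _, .zero _ _ _, h.ren ?_⟩
        rintro _ rfl
        rfl
  | succ d _ ih =>
    cases h with
    | cons h _ _ =>
      rcases ih h hα with h | ⟨hn, S', hS', h⟩
      · exact .inl (.succ _ h)
      · refine .inr ⟨hn, _, .succ _ hS', h.ren ?_⟩
        rintro _ rfl
        rfl

/-- Subsumption along algorithmic subsorting at the simple type `α`. -/
def Subsumption (Sg : Sig) (α : STy) : Prop :=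
  ∀ {Γ : Ctx} {N : Norm} {Δ : Set Srt} {T : Srt}, SCtxOK Sg Γ → SNorm Sg Γ.simple N α →
    (∀ V ∈ Δ, SRefines Sg Γ.simple V α) → (∀ V ∈ Δ, SortCheck Sg Γ N V) →
    SRefines Sg Γ.simple T α → AlgSub Sg α Δ T → SortCheck Sg Γ N T

mutual
-- Synthesis has no subsumption rule, so narrowing may change the synthesized sorts. Either V
-- survives, or the head was narrowed; then the sorts now synthesized lie jointly below V, and the
-- type of R is still within the bound `n`.
theorem SortSynth.narrow_aux (hSg : SigSimple Sg) {n : ℕ}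
    (hn : ∀ γ : STy, sizeOf γ < n → Subsumption Sg γ) :
    ∀ {Γ : Ctx} {R : Atom} {V : Srt}, SortSynth Sg Γ R V → ∀ {Γ' : Ctx} {α : STy},
      CtxSub Sg n Γ' Γ → SCtxOK Sg Γ → SCtxOK Sg Γ' → SAtom Sg Γ.simple R α →
      SortSynth Sg Γ' R V ∨ sizeOf α ≤ n ∧ AlgSub Sg α {W | SortSynth Sg Γ' R W} V
  | _, _, _, .const h, _, _, _, _, _, _ => .inl (.const h)
  | _, _, _, .var h, _, _, hs, _, _, hR => by
    cases hR with
    | var hi =>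
      rcases hs.lookup h hi with h | ⟨hα, S', hS', h⟩
      · exact .inl (.var h)
      · refine .inr ⟨hα, h.mono ?_⟩
        rintro _ rfl
        exact .var hS'
  | Γ, _, _, .app h g hT, Γ', β, hs, hΓ, hΓ', hR => by
    cases hR with
    | @app _ R N α _ hR hN =>
      obtain ⟨rfl, hS, -, -⟩ := (h.sRefines hSg hΓ hR).pi_inv
      have g' := g.narrow_aux hSg hn hs hΓ hΓ' hN hS
      rcases h.narrow_aux hSg hn hs hΓ hΓ' hR with h' | ⟨hα, h'⟩
      · exact .inl (.app h' g' hT)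
      · simp only [STy.arr.sizeOf_spec] at hα
        refine .inr ⟨by omega, ?_⟩
        rw [AlgSub] at h'
        rw [← hs.simple_eq] at hR hN hS
        refine h'.hSub ?_ hT
        -- The narrowed head offers another product, with a domain `S'` above S. The argument is
        -- lifted from S to `S'` by subsumption, as its type is strictly smaller than `n`; simple
        -- typing provides the substitution into the new codomain.
        rintro T' ⟨V, hV, S', A', hc, hs'⟩
        have hV' := SortSynth.comp hV hc
        obtain ⟨e, hS', -, hT'⟩ := (hV'.sRefines hSg hΓ' hR).pi_inv
        obtain ⟨W, hW, -⟩ := hT'.exists_hSub (Ins.zero _ _) hN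
        refine ⟨W, .app hV' ?_ (e ▸ hW), hW⟩
        refine hn _ (by omega) hΓ' hN ?_ ?_ hS' hs'
        · rintro _ rfl; exact hS
        · rintro _ rfl; exact g'
  | _, _, _, .interE₁ h, _, _, hs, hΓ, hΓ', hR => by
    rcases h.narrow_aux hSg hn hs hΓ hΓ' hR with h | ⟨hα, h⟩
    · exact .inl (.interE₁ h)
    · rw [AlgSub] at h
      exact .inr ⟨hα, h.1⟩
  | _, _, _, .interE₂ h, _, _, hs, hΓ, hΓ', hR => by
    rcases h.narrow_aux hSg hn hs hΓ hΓ' hR with h | ⟨hα, h⟩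
    · exact .inl (.interE₂ h)
    · rw [AlgSub] at h
      exact .inr ⟨hα, h.2⟩
theorem SortCheck.narrow_aux (hSg : SigSimple Sg) {n : ℕ}
    (hn : ∀ γ : STy, sizeOf γ < n → Subsumption Sg γ) :
    ∀ {Γ : Ctx} {N : Norm} {S : Srt}, SortCheck Sg Γ N S → ∀ {Γ' : Ctx} {α : STy},
      CtxSub Sg n Γ' Γ → SCtxOK Sg Γ → SCtxOK Sg Γ' → SNorm Sg Γ.simple N α →
      SRefines Sg Γ.simple S α → SortCheck Sg Γ' N S
  | _, _, _, .switch h hQ, _, _, hs, hΓ, hΓ', hN, _ => by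
    cases hN with
    | atom hR =>
      rcases h.narrow_aux hSg hn hs hΓ hΓ' hR with h | ⟨-, h⟩
      · exact .switch h hQ
      · rw [AlgSub] at h
        obtain ⟨V, hV, Q', hc, hQ'⟩ := h
        exact .switch (SortSynth.comp hV hc) (hQ'.trans hQ)
  | _, _, _, .lam h, _, _, hs, hΓ, hΓ', hN, hS => by
    cases hN with
    | lam hN =>
      obtain ⟨rfl, hS, -, hT⟩ := hS.pi_inv
      exact .lam (h.narrow_aux hSg hn (.cons hs rfl (.inl rfl)) (.cons hΓ hS)
        (.cons hΓ' (hs.simple_eq ▸ hS)) hN hT)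
  | _, _, _, .top, _, _, _, _, _, _, _ => .top
  | _, _, _, .inter h₁ h₂, _, _, hs, hΓ, hΓ', hN, hS => by
    cases hS with
    | inter hS₁ hS₂ =>
      exact .inter (h₁.narrow_aux hSg hn hs hΓ hΓ' hN hS₁) (h₂.narrow_aux hSg hn hs hΓ hΓ' hN hS₂)
end

/-- For a product with domain U, the body of the λ is known to check under each domain S above U.
Narrowing moves it to U, after which subsumption at the codomain type applies. -/
theorem subsumption (hSg : SigSimple Sg) (α : STy) : Subsumption Sg α := by
  induction h : sizeOf α using Nat.strong_induction_on generalizing α with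
  | _ n ih =>
    subst h
    intro Γ N Δ T hΓ hN hΔ hc hT h
    induction T with
    | top => exact .top
    | inter T₁ T₂ ih₁ ih₂ =>
      cases hT with
      | inter hT₁ hT₂ =>
        rw [AlgSub] at h
        exact .inter (ih₁ hT₁ h.1) (ih₂ hT₂ h.2)
    | atom Q =>
      rw [AlgSub] at h
      obtain ⟨V, hV, Q', hQ', hs⟩ := h
      cases (hc V hV).comp hQ' with
      | switch h hs' => exact .switch h (hs'.trans hs)
    | pi U A T =>
      cases α with
      | base a => cases hT
      | arr α β =>
        obtain ⟨hA, hU, -, hT⟩ := hT.pi_inv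
        subst hA
        rw [AlgSub] at h
        simp only [STy.arr.sizeOf_spec] at ih
        cases hN with
        | lam hN =>
          refine .lam (ih _ (by omega) β rfl (.cons hΓ hU) hN ?_ ?_ hT h)
          · rintro W ⟨V, hV, S, B, hVc, -⟩
            exact ((hΔ V hV).comp hVc).pi_inv.2.2.2
          · rintro W ⟨V, hV, S, B, hVc, hs⟩
            obtain ⟨e, hS, -, hW⟩ := ((hΔ V hV).comp hVc).pi_inv
            cases (hc V hV).comp hVc with
            | lam hNW =>
              -- Only a variable of the domain type is narrowed, so the subsumption required is at
              -- types below that size, within reach of the induction.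
              refine hNW.narrow_aux hSg (n := sizeOf A.erase)
                (fun γ hγ => ih _ (by omega) γ rfl)
                (.cons (.refl _ Γ) e.symm (.inr ⟨by rw [e], e ▸ hs⟩)) (.cons hΓ (e ▸ hS))
                (.cons hΓ hU) (α := β) ?_ ?_
              · simpa [Ctx.simple, e] using hN
              · simpa [Ctx.simple, e] using hW

theorem SortCheck.narrow (hSg : SigSimple Sg) {n : ℕ} {Γ Γ' : Ctx} {N : Norm} {S : Srt}
    {α : STy} (h : SortCheck Sg Γ N S) (hs : CtxSub Sg n Γ' Γ) (hΓ : SCtxOK Sg Γ)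
    (hΓ' : SCtxOK Sg Γ') (hN : SNorm Sg Γ.simple N α) (hS : SRefines Sg Γ.simple S α) :
    SortCheck Sg Γ' N S :=
  h.narrow_aux hSg (fun γ _ => subsumption hSg γ) hs hΓ hΓ' hN hS

theorem ClsSynth.sClsRefines (hSg : SigSimple Sg) {Γ : Ctx} {Q : AtomSrt} {P : AtomTy} {L : Cls}
    (h : ClsSynth Sg Γ Q P L) {D : List STy} {κ : List STy} (hP : SAtomTy Sg D P κ) :
    SClsRefines Sg D L κ := by
  induction h generalizing κ with
  | const h =>
    cases hP with
    | const ha =>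
      obtain ⟨K, hK, hL⟩ := hSg.srtConst_ok h
      cases hSg.tyConst_unique hK ha
      exact hL.mono (List.Subset.refl _) (.nil _ _)
  | app _ _ hs ih =>
    cases hP with
    | app hP hN =>
      cases ih hP with
      | pi _ _ hL =>
        obtain ⟨L', h', hL'⟩ := hL.exists_hSub (Ins.zero _ _) hN
        rwa [hs.functional h']
  | interE₁ _ ih => cases ih hP with | inter h _ => exact h
  | interE₂ _ ih => cases ih hP with | inter _ h => exact h

theorem ClsSynth.narrow (hSg : SigSimple Sg) {n : ℕ} {Γ Γ' : Ctx} {Q : AtomSrt} {P : AtomTy}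
    {L : Cls} {κ : List STy} (h : ClsSynth Sg Γ Q P L) (hs : CtxSub Sg n Γ' Γ)
    (hΓ : SCtxOK Sg Γ) (hΓ' : SCtxOK Sg Γ') (hP : SAtomTy Sg Γ.simple P κ) :
    ClsSynth Sg Γ' Q P L := by
  induction h generalizing κ with
  | const h => exact .const h
  | app h hN hL ih =>
    cases hP with
    | app hP hN' =>
      cases h.sClsRefines hSg hP with
      | pi hS _ _ => exact .app (ih hP) (hN.narrow hSg hs hΓ hΓ' hN' hS) hL
  | interE₁ _ ih => exact .interE₁ (ih hP)
  | interE₂ _ ih => exact .interE₂ (ih hP)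

/-- Class synthesis meets the context only through sort checking of arguments, so stability of
refinement reduces to `SortCheck.narrow`. -/
theorem Refines.narrow (hSg : SigSimple Sg) {n : ℕ} {Γ Γ' : Ctx} {S : Srt} {A : Ty}
    (h : Refines Sg Γ S A) (hs : CtxSub Sg n Γ' Γ) (hΓ : SCtxOK Sg Γ) (hΓ' : SCtxOK Sg Γ')
    (hA : STyOK Sg Γ.simple A) : Refines Sg Γ' S A := by
  induction h generalizing Γ' with
  | atom h => cases hA with | atom hP => exact .atom (h.narrow hSg hs hΓ hΓ' hP)
  | pi h _ ih₁ ih₂ =>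
    cases hA with
    | pi hA hB =>
      have hS := h.sRefines hA
      exact .pi (ih₁ hs hΓ hΓ' hA) (ih₂ (.cons hs rfl (.inl rfl)) (.cons hΓ hS)
        (.cons hΓ' (hs.simple_eq ▸ hS)) hB)
  | top => exact .top
  | inter _ _ ih₁ ih₂ => exact .inter (ih₁ hs hΓ hΓ' hA) (ih₂ hs hΓ hΓ' hA)

/-! ### From algorithmic to declarative subsorting -/

/-- The intersection of a list of sorts. -/
def interList : List Srt → Srt
  | [] => .top
  | V :: l => .inter V (interList l)

theorem Refines.interList {Γ : Ctx} {A : Ty} : ∀ {l : List Srt},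
    (∀ V ∈ l, Refines Sg Γ V A) → Refines Sg Γ (interList l) A
  | [], _ => .top
  | V :: l, h => .inter (h V (by simp)) (Refines.interList fun W hW => h W (by simp [hW]))

theorem DeclSub.of_comp {Γ : Ctx} {S V : Srt} {A : Ty} (h : Comp S V) (hS : Refines Sg Γ S A) :
    DeclSub Sg Γ S V A := by
  induction h with
  | refl => exact .refl hS
  | left _ ih => cases hS with | inter h₁ h₂ => exact .interL₁ h₂ (ih h₁)
  | right _ ih => cases hS with | inter h₁ h₂ => exact .interL₂ h₁ (ih h₂)

theorem DeclSub.interList_append_left {Γ : Ctx} {A : Ty} : ∀ {l l' : List Srt},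
    (∀ V ∈ l, Refines Sg Γ V A) → (∀ V ∈ l', Refines Sg Γ V A) →
    DeclSub Sg Γ (interList (l ++ l')) (interList l) A
  | [], _, _, h' => .topR (.interList h')
  | V :: l, l', h, h' => by
    have hl : ∀ W ∈ l, Refines Sg Γ W A := fun W hW => h W (by simp [hW])
    have hll' : Refines Sg Γ (LFR.interList (l ++ l')) A := .interList fun W hW =>
      (List.mem_append.1 hW).elim (hl W) (h' W)
    exact .interR (.interL₁ hll' (.refl (h V (by simp))))
      (.interL₂ (h V (by simp)) (.interList_append_left hl h'))

theorem DeclSub.interList_append_right {Γ : Ctx} {A : Ty} : ∀ {l l' : List Srt},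
    (∀ V ∈ l, Refines Sg Γ V A) → (∀ V ∈ l', Refines Sg Γ V A) →
    DeclSub Sg Γ (interList (l ++ l')) (interList l') A
  | [], _, _, h' => .refl (.interList h')
  | V :: _, _, h, h' => .interL₂ (h V (by simp))
      (.interList_append_right (fun W hW => h W (by simp [hW])) h')

theorem DeclSub.interList_of_forall_eq {Γ : Ctx} {A : Ty} {S : Srt} (hS : Refines Sg Γ S A) :
    ∀ {l : List Srt}, (∀ V ∈ l, V = S) → DeclSub Sg Γ S (interList l) A
  | [], _ => .topR hS
  | V :: _, h => .interR (by rw [h V (by simp)]; exact .refl hS)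
      (.interList_of_forall_eq hS fun W hW => h W (by simp [hW]))

/-- Contravariance is used to make the domains of the function sorts in `l` agree with `U`. -/
theorem DeclSub.interList_pi {Γ : Ctx} {A B : Ty} {U : Srt} {Δ : Set Srt}
    (hU : Refines Sg Γ U A) (hΔ : ∀ V ∈ Δ, Refines Sg Γ V (.pi A B)) : ∀ {l : List Srt},
    (∀ T ∈ l, Refines Sg ((U, A) :: Γ) T B) →
    (∀ T ∈ l, ∃ V ∈ Δ, DeclSub Sg Γ V (.pi U A T) (.pi A B)) →
    ∃ l', (∀ V ∈ l', V ∈ Δ) ∧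
      DeclSub Sg Γ (interList l') (.pi U A (interList l)) (.pi A B)
  | [], _, _ => ⟨[], by simp, .topPi hU⟩
  | T :: l, hl, h => by
    have hl' : ∀ T ∈ l, Refines Sg ((U, A) :: Γ) T B := fun W hW => hl W (by simp [hW])
    obtain ⟨l', hl'Δ, h'⟩ := DeclSub.interList_pi hU hΔ hl' fun W hW => h W (by simp [hW])
    obtain ⟨V, hV, hVT⟩ := h T (by simp)
    refine ⟨V :: l', by simpa using ⟨hV, hl'Δ⟩, ?_⟩
    -- With equal domains, the distributivity rule merges the new codomain with those already
    -- collected; the empty list was covered by ⊤ ≤ Π U. ⊤.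
    refine .trans (.interR ?_ ?_) (.interPi hU (hl T (by simp)) (.interList hl'))
    · exact .interL₁ (.interList fun W hW => hΔ W (hl'Δ W hW)) hVT
    · exact .interL₂ (hΔ V hV) h'

/-- Δ may be infinite, but T is finite and uses only finitely many members, so a list can be
extracted whose intersection is an actual sort. -/
theorem AlgSub.declSub (hSg : SigSimple Sg) {α : STy} : ∀ {Γ : Ctx} {A : Ty} {Δ : Set Srt}
    {T : Srt}, A.erase = α → SCtxOK Sg Γ → STyOK Sg Γ.simple A →
    (∀ V ∈ Δ, Refines Sg Γ V A) → Refines Sg Γ T A → AlgSub Sg α Δ T →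
    ∃ l, (∀ V ∈ l, V ∈ Δ) ∧ DeclSub Sg Γ (interList l) T A := by
  have aux : ∀ (α : STy),
      (∀ {Γ : Ctx} {A : Ty} {Δ : Set Srt} {S B T}, A.erase = α → SCtxOK Sg Γ →
        STyOK Sg Γ.simple A → (∀ V ∈ Δ, Refines Sg Γ V A) → Refines Sg Γ (.pi S B T) A →
        AlgSub Sg α Δ (.pi S B T) →
        ∃ l, (∀ V ∈ l, V ∈ Δ) ∧ DeclSub Sg Γ (interList l) (.pi S B T) A) →
      ∀ {Γ : Ctx} {A : Ty} {Δ : Set Srt}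
        {T : Srt}, A.erase = α → SCtxOK Sg Γ → STyOK Sg Γ.simple A →
        (∀ V ∈ Δ, Refines Sg Γ V A) → Refines Sg Γ T A → AlgSub Sg α Δ T →
        ∃ l, (∀ V ∈ l, V ∈ Δ) ∧ DeclSub Sg Γ (interList l) T A := by
    intro α hpi Γ A Δ T e hΓ hA hΔ hT h
    induction T with
    | top => exact ⟨[], by simp, .refl .top⟩
    | inter T₁ T₂ ih₁ ih₂ =>
      cases hT with
      | inter hT₁ hT₂ =>
        rw [AlgSub] at h
        obtain ⟨l₁, hl₁, h₁⟩ := ih₁ hT₁ h.1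
        obtain ⟨l₂, hl₂, h₂⟩ := ih₂ hT₂ h.2
        have hr₁ := fun V hV => hΔ V (hl₁ V hV)
        have hr₂ := fun V hV => hΔ V (hl₂ V hV)
        exact ⟨l₁ ++ l₂, fun V hV => (List.mem_append.1 hV).elim (hl₁ V) (hl₂ V),
          .interR (.trans (.interList_append_left hr₁ hr₂) h₁)
            (.trans (.interList_append_right hr₁ hr₂) h₂)⟩
    | atom Q =>
      rw [AlgSub] at h
      obtain ⟨V, hV, Q', hc, hs⟩ := h
      refine ⟨[V], by simpa using hV, ?_⟩
      cases A with
      | pi => cases hT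
      | atom P =>
        -- The intersection of the list `[V]` is V ∧ ⊤, hence the projection.
        exact .interL₁ .top
          (.trans (.of_comp hc (hΔ V hV)) (.atomic ((hΔ V hV).comp hc) hT hs))
    | pi => exact hpi e hΓ hA hΔ hT h
  induction α with
  | base a =>
    intro Γ A Δ T
    refine aux _ fun _ _ _ _ _ h => ?_
    rw [AlgSub] at h
    exact h.elim
  | arr α β ihα ihβ =>
    intro Γ A Δ T
    refine aux _ fun {Γ A Δ U A₁ T} e hΓ hA hΔ hT h => ?_
    rw [AlgSub] at h
    cases hT with
    | @pi _ _ _ _ B hU hT =>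
      cases e
      cases hA with
      | pi hA hB =>
        have hΓU : SCtxOK Sg ((U, A₁) :: Γ) := .cons hΓ (hU.sRefines hA)
        have key : ∀ W ∈ {T' | ∃ V ∈ Δ, ∃ S A', Comp V (.pi S A' T') ∧
            AlgSub Sg A₁.erase {U} S}, Refines Sg ((U, A₁) :: Γ) W B ∧
            ∃ V ∈ Δ, DeclSub Sg Γ V (.pi U A₁ W) (.pi A₁ B) := by
          rintro W ⟨V, hV, S, A', hc, hs⟩
          have hVc := (hΔ V hV).comp hc
          cases hVc with
          | pi hS hW =>
            -- W is known to refine B only under the domain S; the product with domain U is well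
            -- formed only after narrowing.
            have hW' := hW.narrow hSg (n := sizeOf A₁.erase)
              (.cons (.refl _ Γ) rfl (.inr ⟨le_rfl, hs⟩)) (.cons hΓ (hS.sRefines hA)) hΓU hB
            obtain ⟨l, hl, hd⟩ := ihα rfl hΓ hA (by rintro _ rfl; exact hU) hS hs
            have hUS : DeclSub Sg Γ U S A₁ := .trans (.interList_of_forall_eq hU hl) hd
            exact ⟨hW', V, hV, .trans (.of_comp hc (hΔ V hV)) (.pi hW hUS (.refl hW'))⟩
        obtain ⟨l, hl, hd⟩ := ihβ rfl hΓU hB (fun W hW => (key W hW).1) hT h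
        have hlr := fun W hW => (key W (hl W hW)).1
        obtain ⟨l', hl', hd'⟩ := DeclSub.interList_pi hU hΔ hlr fun W hW => (key W (hl W hW)).2
        exact ⟨l', hl', .trans hd' (.pi (.interList hlr) (.refl hU) hd)⟩

end

end LFR

-- The completeness theorem

theorem mainTheorem6 (Sg : LFR.Sig) (Γ : LFR.Ctx) (S T : LFR.Srt) (A : LFR.Ty)
    (hSg : LFR.SigOK Sg) (hΓ : LFR.CtxOK Sg Γ) (hA : LFR.TyOK Sg Γ.erase A)
    (hS : LFR.Refines Sg Γ S A) (hT : LFR.Refines Sg Γ T A)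
    (h : LFR.SortCheck Sg ((S, A) :: Γ) (LFR.eta A.erase (.var 0)) T.shift) :
    LFR.DeclSub Sg Γ S T A := by
  have hA' : LFR.STyOK Sg Γ.simple A := LFR.Ctx.map_erase_erase Γ ▸ hA.sTyOK
  have hsub : LFR.AlgSub Sg A.erase {S} T := by
    refine LFR.AlgSub.of_shift (LFR.SortCheck.algSub (D := A.erase :: Γ.simple)
      (LFR.SynthWithin.var Sg Γ [] S A) ?_ ((hT.sRefines hA').shift _) h)
    rintro _ rfl
    exact (hS.sRefines hA').shift _
  obtain ⟨l, hl, hd⟩ := hsub.declSub hSg.sigSimple rfl hΓ.sCtxOK hA'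
    (by rintro _ rfl; exact hS) hT
  -- The extracted list consists of copies of S, possibly none, so S lies below its intersection.
  exact .trans (.interList_of_forall_eq hS hl) hd
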